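/- An $r$-graph is an $r$-uniform hypergraph (without repeated edges); it is linear if any two distinct edges share at most one vertex. For integers $r\ge 3$ and $m\ge 3$, the $r$-uniform linear cycle $C^r_m$ of length $m$ is the linear $r$-graph with $m$ edges $e_1,\dots,e_m$ on $(r-1)m$ vertices such that (indices modulo $m$) $|e_i\cap e_j|=1$ if $j=i\pm1$, and $e_i\cap e_j=\emptyset$ for all other pairs $i\ne j$. For a linear $r$-graph $H$ with at least one edge, the linear Turán number $\mathrm{ex}_L(n,H)$ is the maximum number of edges in an $n$-vertex linear $r$-graph that does not contain $H$ as a (not necessarily induced) subgraph. Let $r\ge 3$ and $k\ge 2$ be integers. Then for all integers $n\ge 0$, $$\mathrm{ex}_L(n, C^r_{2k})\le 64\,k^2\,r^{2r+3}\, n^{1+1/k}.$$ -/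

import Mathlib

namespace Hypergraph

/-- `H` is an `r`-graph: every edge has exactly `r` vertices. (Edges are sets of vertices, so there
are no repeated edges.) -/
def IsUniform {α : Type*} (H : Hypergraph α) (r : ℕ) : Prop :=
  ∀ e ∈ H.edgeSet, e.encard = r

/-- `H` is linear: any two distinct edges share at most one vertex. -/
def IsLinear {α : Type*} (H : Hypergraph α) : Prop :=
  ∀ e ∈ H.edgeSet, ∀ f ∈ H.edgeSet, e ≠ f → (e ∩ f).encard ≤ 1

/-- `G` contains `H` as a (not necessarily induced) subgraph: some injection of the vertices of `H`
into those of `G` carries every edge of `H` onto an edge of `G`. -/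
def ContainsCopy {α β : Type*} (G : Hypergraph α) (H : Hypergraph β) : Prop :=
  ∃ φ : H.vertexSet ↪ G.vertexSet,
    ∀ e ∈ H.edgeSet, (fun x => (φ x : α)) '' {x : H.vertexSet | (x : β) ∈ e} ∈ G.edgeSet

/-- The numbers of edges of the linear `r`-graphs on `n` vertices that do not contain `H`. -/
def linearTuranSet {β : Type*} (n r : ℕ) (H : Hypergraph β) : Set ℕ :=
  {m | ∃ G : Hypergraph (Fin n), G.vertexSet = Set.univ ∧ G.IsUniform r ∧ G.IsLinear ∧
    ¬ G.ContainsCopy H ∧ G.edgeSet.ncard = m}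

/-- The linear Turán number of the linear `r`-graph `H`: the maximum number of edges in an
`n`-vertex linear `r`-graph that does not contain `H` as a subgraph. -/
noncomputable def linearTuranNumber {β : Type*} (n r : ℕ) (H : Hypergraph β) : ℕ :=
  sSup (linearTuranSet n r H)

/-- If `H` has an edge, then the supremum that defines the linear Turán number is a maximum. -/
theorem isGreatest_linearTuranNumber {β : Type*} (n r : ℕ) (H : Hypergraph β)
    (hH : H.edgeSet.Nonempty) :
    IsGreatest (linearTuranSet n r H) (linearTuranNumber n r H) := by
  have hb : BddAbove (linearTuranSet n r H) := by
    refine ⟨(Set.univ : Set (Set (Fin n))).ncard, ?_⟩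
    rintro m ⟨G, -, -, -, -, rfl⟩
    exact Set.ncard_le_ncard (Set.subset_univ _) Set.finite_univ
  have hne : (linearTuranSet n r H).Nonempty := by
    refine ⟨0, trivialOn Set.univ, rfl, ?_, ?_, ?_, ?_⟩
    · intro e he
      simp at he
    · intro e he
      simp at he
    · rintro ⟨φ, hφ⟩
      obtain ⟨e, he⟩ := hH
      have := hφ e he
      simp at this
    · simp
  exact ⟨Nat.sSup_mem hne hb, fun m hm => le_csSup hb hm⟩

/-- The `i`-th edge of the linear cycle of length `m`: all `r - 1` vertices of the `i`-th block,
together with the first vertex of the next block (cyclically). -/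
def linearCycleEdge (r m : ℕ) (i : ZMod m) : Set (ZMod m × Fin (r - 1)) :=
  {v | v.1 = i ∨ (v.1 = i + 1 ∧ (v.2 : ℕ) = 0)}

/-- The `r`-uniform linear cycle of length `m` (meant for `r ≥ 2` and `m ≥ 3`): `m` edges of size
`r` on `(r - 1) * m` vertices, cyclically consecutive edges sharing exactly one vertex and all other
pairs of edges being disjoint. -/
def linearCycle (r m : ℕ) : Hypergraph (ZMod m × Fin (r - 1)) where
  vertexSet := Set.univ
  edgeSet := Set.range (linearCycleEdge r m)
  subset_vertexSet_of_mem_edgeSet' := fun e _ => Set.subset_univ e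


/-- `linearCycle r m` has the defining properties of the `r`-uniform linear cycle of length `m`. -/
theorem linearCycle_spec (r m : ℕ) (hr : 2 ≤ r) (hm : 3 ≤ m) :
    (linearCycle r m).vertexSet.ncard = (r - 1) * m ∧
    (linearCycle r m).edgeSet.ncard = m ∧
    (linearCycle r m).IsUniform r ∧
    (linearCycle r m).IsLinear ∧
    (∀ i, (linearCycleEdge r m i ∩ linearCycleEdge r m (i + 1)).encard = 1) ∧
    (∀ i j, j ≠ i → j ≠ i + 1 → i ≠ j + 1 →
      linearCycleEdge r m i ∩ linearCycleEdge r m j = ∅) := by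
  have : NeZero m := ⟨by omega⟩
  have hr1 : 0 < r - 1 := by omega
  have h1 : ∀ i : ZMod m, i + 1 ≠ i := by
    intro i h
    have h' : ((1 : ℕ) : ZMod m) = 0 := by simpa using h
    rw [ZMod.natCast_eq_zero_iff] at h'
    have := Nat.le_of_dvd (by norm_num) h'
    omega
  have h2 : ∀ i : ZMod m, i + 1 + 1 ≠ i := by
    intro i h
    have h' : ((2 : ℕ) : ZMod m) = 0 := by
      have : i + (1 + 1) = i + 0 := by rw [← add_assoc, h, add_zero]
      have := add_left_cancel this
      push_cast
      rw [← this]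
      norm_num
    rw [ZMod.natCast_eq_zero_iff] at h'
    have := Nat.le_of_dvd (by norm_num) h'
    omega
  have hcons : ∀ i, linearCycleEdge r m i ∩ linearCycleEdge r m (i + 1) =
      {(i + 1, ⟨0, hr1⟩)} := by
    intro i
    ext ⟨a, b⟩
    simp only [linearCycleEdge, Set.mem_inter_iff, Set.mem_ofPred_eq, Set.mem_singleton_iff,
      Prod.mk.injEq, Fin.ext_iff]
    constructor
    · rintro ⟨h | ⟨h, hb⟩, h' | ⟨h', hb'⟩⟩
      · exact absurd (h'.symm.trans h) (h1 i)
      · exact absurd (h'.symm.trans h) (h2 i)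
      · exact ⟨h, hb⟩
      · exact ⟨h, hb⟩
    · rintro ⟨h, hb⟩
      exact ⟨Or.inr ⟨h, hb⟩, Or.inl h⟩
  have hdisj : ∀ i j, j ≠ i → j ≠ i + 1 → i ≠ j + 1 →
      linearCycleEdge r m i ∩ linearCycleEdge r m j = ∅ := by
    intro i j h0 h3 h4
    ext ⟨a, b⟩
    simp only [linearCycleEdge, Set.mem_inter_iff, Set.mem_ofPred_eq, Set.mem_empty_iff_false,
      iff_false]
    rintro ⟨h | ⟨h, hb⟩, h' | ⟨h', hb'⟩⟩
    · exact h0 (h'.symm.trans h)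
    · exact h4 (h.symm.trans h')
    · exact h3 (h'.symm.trans h)
    · exact h0 (add_right_cancel (h'.symm.trans h))
  have hcard : ∀ i, (linearCycleEdge r m i).encard = r := by
    intro i
    have he : linearCycleEdge r m i =
        insert (i + 1, ⟨0, hr1⟩) ((fun b => (i, b)) '' (Set.univ : Set (Fin (r - 1)))) := by
      ext ⟨a, b⟩
      simp only [linearCycleEdge, Set.mem_ofPred_eq, Set.mem_insert_iff, Prod.mk.injEq,
        Fin.ext_iff, Set.mem_image, Set.mem_univ, true_and]
      constructor
      · rintro (h | h)
        · exact Or.inr ⟨b, h.symm, rfl⟩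
        · exact Or.inl h
      · rintro (h | ⟨x, h, -⟩)
        · exact Or.inr h
        · exact Or.inl h.symm
    rw [he, Set.encard_insert_of_notMem, Function.Injective.encard_image, Set.encard_univ]
    · simp only [ENat.card_eq_coe_fintype_card, Fintype.card_fin]
      exact_mod_cast (by omega : r - 1 + 1 = r)
    · intro x y h
      simpa using h
    · rintro ⟨b, -, h⟩
      exact h1 i (Prod.mk.inj h).1.symm
  have hinj : Function.Injective (linearCycleEdge r m) := by
    intro i j h
    by_contra hij
    have key : ∀ i, (linearCycleEdge r m i ∩ linearCycleEdge r m (i + 1)).encard ≠ r := by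
      intro i
      rw [hcons, Set.encard_singleton]
      exact_mod_cast (by omega : 1 ≠ r)
    by_cases h3 : j = i + 1
    · apply key i
      rw [← h3, ← h, Set.inter_self, hcard]
    by_cases h4 : i = j + 1
    · apply key j
      rw [← h4, h, Set.inter_self, hcard]
    · have := hdisj i j (Ne.symm hij) h3 h4
      rw [← h, Set.inter_self] at this
      have hc := hcard i
      rw [this, Set.encard_empty] at hc
      have : (0 : ℕ) = r := by exact_mod_cast hc
      omega
  refine ⟨?_, ?_, ?_, ?_, ?_, hdisj⟩
  · simp [linearCycle, Set.ncard_univ, mul_comm]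
  · simp only [linearCycle]
    rw [← Set.image_univ, Set.ncard_image_of_injective _ hinj, Set.ncard_univ, Nat.card_zmod]
  · rintro _ ⟨i, rfl⟩
    exact hcard i
  · rintro _ ⟨i, rfl⟩ _ ⟨j, rfl⟩ hne
    by_cases h3 : j = i + 1
    · rw [h3, hcons, Set.encard_singleton]
    by_cases h4 : i = j + 1
    · rw [h4, Set.inter_comm, hcons, Set.encard_singleton]
    · rw [hdisj i j (fun h => hne (by rw [h])) h3 h4]
      simp
  · intro i
    rw [hcons, Set.encard_singleton]

end Hypergraph

/-! The argument follows the breadth-first search proof for even cycles in graphs. Deleting vertices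
of low degree leaves a subfamily in which every covered vertex has degree above a constant times `n
^ (1 / k)`. If there is no linear cycle of length `2 * k`, a tree grown in it gains a factor `2 * n
^ (1 / k)` per level, so at height `k` it would have more than `n` vertices.

The tree is a `LinearTree`: it is continued through only one spine vertex of each edge, so two paths
to the root that share an edge, other than as the first edge of both, pass through the same vertices
from there on. A new level is a maximal family of edges hanging from last-level spine vertices and
disjoint outside the tree (`exists_extension`). By maximality, every edge through such a spine
vertex has a second vertex in the larger tree. The degree condition makes these edges numerous,
while `card_edges_le` bounds them by a constant times the size of the tree; comparing the two gives
the growth (`exists_large`).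

For `card_edges_le`, mark in each edge a vertex `w` of minimal level `l` and another tree vertex
`x`. Among the edges with a given `x`, if they are numerous, a quarter have root paths from `w` that
separate from the path of one designated edge `e₀` at the same height `h` (`exists_split_level`). If
too many edges share one value of `h`, a directed cut and a passage to large degree allow a greedy
path, alternating between joints `x` and `w`, of length `2 * (k - h - 2) + 1` from some `x` to some
`w` (`exists_greedy_linearPath`). Climbing `h + 1` tree edges, descending `h + 1` edges to the
marked vertex of `e₀` and returning to `x` through `e₀` gives a cycle of length exactly `2 * k`.

This yields the constant `264 * k ^ 2 * r ^ 4`, which is at most the required one for `r ≥ 3`. -/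

/-! ### Linear paths. -/

/-- `IsLinearPath a L b`: the edges of the list `L`, in this order, form a linear path
from `a` to `b`. -/
def IsLinearPath {V : Type*} : V → List (Finset V) → V → Prop
  | a, [], b => a = b
  | a, e :: L, b => ∃ c, a ∈ e ∧ c ∈ e ∧ a ≠ c ∧ (∀ f ∈ L, ∀ z ∈ e, z ∈ f → z = c) ∧
      IsLinearPath c L b

namespace IsLinearPath

variable {V : Type*}

theorem exists_end_mem {L : List (Finset V)} {a b : V} (h : IsLinearPath a L b) (hL : L ≠ []) :
    ∃ f ∈ L, b ∈ f := by
  induction L generalizing a with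
  | nil => exact absurd rfl hL
  | cons e L ih =>
    obtain ⟨c, -, hc, -, -, hp⟩ := h
    cases L with
    | nil =>
      cases hp
      exact ⟨e, by simp, hc⟩
    | cons f L =>
      obtain ⟨g, hg, hb⟩ := ih hp (by simp)
      exact ⟨g, List.mem_cons_of_mem _ hg, hb⟩

theorem singleton {e : Finset V} {a b : V} (ha : a ∈ e) (hb : b ∈ e) (hab : a ≠ b) :
    IsLinearPath a [e] b :=
  ⟨b, ha, hb, hab, by simp, rfl⟩

theorem append {L M : List (Finset V)} {a b c : V} (hL : IsLinearPath a L b)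
    (hM : IsLinearPath b M c) (hLM : ∀ e ∈ L, ∀ f ∈ M, ∀ z ∈ e, z ∈ f → z = b) :
    IsLinearPath a (L ++ M) c := by
  induction L generalizing a with
  | nil =>
    cases hL
    exact hM
  | cons e L ih =>
    obtain ⟨d, ha, hd, had, hint, hp⟩ := hL
    refine ⟨d, ha, hd, had, ?_, ih hp fun e he => hLM e (List.mem_cons_of_mem _ he)⟩
    intro f hf z hze hzf
    rcases List.mem_append.1 hf with hf | hf
    · exact hint f hf z hze hzf
    -- The end `b` also lies in an edge of the rest of the first path, so the intersection condition
    -- there identifies it with `d`.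
    · have hzb := hLM e (by simp) f hf z hze hzf
      subst hzb
      cases L with
      | nil => exact hp.symm
      | cons g L =>
        obtain ⟨g', hg', hz⟩ := hp.exists_end_mem (by simp)
        exact hint g' hg' z hze hz

theorem reverse {L : List (Finset V)} {a b : V} (hL : IsLinearPath a L b) :
    IsLinearPath b L.reverse a := by
  induction L generalizing a with
  | nil => exact hL.symm
  | cons e L ih =>
    obtain ⟨d, ha, hd, had, hint, hp⟩ := hL
    rw [List.reverse_cons]
    refine (ih hp).append (singleton hd ha had.symm) ?_
    intro f hf g hg z hzf hzg
    rw [List.mem_singleton] at hg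
    subst hg
    exact hint f (List.mem_reverse.1 hf) z hzg hzf

/-- The recursive definition allows an edge to meet all later ones in its exit joint.
Non-consecutive edges are nevertheless disjoint: a joint lying in a third edge would coincide with
the next joint. -/
theorem exists_vertices {L : List (Finset V)} {a b : V} (hL : IsLinearPath a L b) :
    ∃ v : ℕ → V, v 0 = a ∧ v L.length = b ∧
      (∀ i (h : i < L.length), v i ∈ L[i] ∧ v (i + 1) ∈ L[i] ∧ v i ≠ v (i + 1)) ∧
      ∀ i j (hi : i < L.length) (hj : j < L.length), i < j →
        ∀ z ∈ L[i], z ∈ L[j] → j = i + 1 ∧ z = v j := by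
  induction L generalizing a with
  | nil => exact ⟨fun _ => a, rfl, hL, by simp, by simp⟩
  | cons e L ih =>
    obtain ⟨c, ha, hc, hac, hint, hp⟩ := hL
    obtain ⟨v, hv0, hvL, hv, hvi⟩ := ih hp
    refine ⟨fun i => Nat.casesOn i a v, rfl, hvL, ?_, ?_⟩
    · rintro (_ | i) h
      · simp [hv0, ha, hc, hac]
      · simpa using hv i (by simpa using h)
    · rintro (_ | i) (_ | j) hi hj hij z hz hz'
      · omega
      · simp only [List.getElem_cons_zero, List.getElem_cons_succ] at hz hz'
        have hj' : j < L.length := by simpa using hj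
        have hzc := hint _ (List.getElem_mem hj') z hz hz'
        rcases Nat.eq_zero_or_pos j with rfl | hj0
        · exact ⟨rfl, by simp [hzc, hv0]⟩
        · exfalso
          have h0 : 0 < L.length := by omega
          have hz0 : z ∈ L[0] := by rw [hzc, ← hv0]; exact (hv 0 h0).1
          obtain ⟨h1, h2⟩ := hvi 0 j h0 hj' hj0 z hz0 hz'
          apply (hv 0 h0).2.2
          rw [hv0, ← hzc, h2, h1]
      · omega
      · simp only [List.getElem_cons_succ] at hz hz'
        obtain ⟨h1, h2⟩ := hvi i j (by simpa using hi) (by simpa using hj) (by omega) z hz hz'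
        exact ⟨by omega, h2⟩

end IsLinearPath

/-! ### Closing linear paths to linear cycles. -/

namespace Hypergraph

/-- Labels one block of the cycle: the exit joint `b` belongs to the next block, and the entry joint
`a` needs index `0`, the index shared in `linearCycleEdge`. -/
theorem exists_enumeration {V : Type*} [DecidableEq V] {r : ℕ} (hr : 2 ≤ r) {e : Finset V} {a b : V}
    (he : e.card = r) (ha : a ∈ e) (hb : b ∈ e) (hab : a ≠ b) :
    ∃ σ : Fin (r - 1) → V, Function.Injective σ ∧ σ ⟨0, by omega⟩ = a ∧
      Set.range σ = (e.erase b : Finset V) := by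
  have hcard : (e.erase b).card = r - 1 := by rw [Finset.card_erase_of_mem hb, he]
  let τ : Fin (r - 1) ≃ e.erase b := (Finset.equivFinOfCardEq hcard).symm
  let a' : e.erase b := ⟨a, Finset.mem_erase.2 ⟨hab, ha⟩⟩
  let ρ := (Equiv.swap ⟨0, by omega⟩ (τ.symm a')).trans τ
  refine ⟨fun i => ρ i, Subtype.val_injective.comp ρ.injective, ?_, ?_⟩
  · simp [ρ, a']
  · ext z
    constructor
    · rintro ⟨i, rfl⟩
      exact (ρ i).2
    · intro hz
      exact ⟨ρ.symm ⟨z, hz⟩, by simp⟩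

/-- Block `i` is sent onto `g i` without `v (i + 1)`. Blocks stay disjoint because a common vertex
of two edges is a joint, which has been removed from one of them. -/
theorem containsCopy_linearCycle_of_zmod {V : Type*} [DecidableEq V] {G : Hypergraph V}
    (hG : G.vertexSet = Set.univ) {r m : ℕ} (hr : 2 ≤ r) (g : ZMod m → Finset V) (v : ZMod m → V)
    (hg : ∀ i, (g i : Set V) ∈ G.edgeSet) (hcard : ∀ i, (g i).card = r)
    (hv : ∀ i, v i ∈ g i) (hv' : ∀ i, v (i + 1) ∈ g i) (hne : ∀ i, v i ≠ v (i + 1))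
    (hint : ∀ i j, i ≠ j → ∀ z ∈ g i, z ∈ g j → (j = i + 1 ∧ z = v j) ∨ (i = j + 1 ∧ z = v i)) :
    G.ContainsCopy (linearCycle r m) := by
  choose σ hσ hσ0 hσr using fun i => exists_enumeration hr (hcard i) (hv i) (hv' i) (hne i)
  have hmem : ∀ i b, σ i b ∈ g i ∧ σ i b ≠ v (i + 1) := by
    intro i b
    have : σ i b ∈ ((g i).erase (v (i + 1)) : Finset V) := by
      rw [← Finset.mem_coe, ← hσr i]
      exact ⟨b, rfl⟩
    exact ⟨Finset.mem_of_mem_erase this, Finset.ne_of_mem_erase this⟩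
  have hinj : Function.Injective fun p : ZMod m × Fin (r - 1) => σ p.1 p.2 := by
    rintro ⟨i, b⟩ ⟨j, c⟩ h
    simp only at h
    by_cases hij : i = j
    · subst hij
      rw [hσ i h]
    · rcases hint i j hij _ (hmem i b).1 (h ▸ (hmem j c).1) with ⟨h1, h2⟩ | ⟨h1, h2⟩
      · exact absurd (h1 ▸ h2) (hmem i b).2
      · rw [h] at h2
        exact absurd (h1 ▸ h2) (hmem j c).2
  refine ⟨⟨fun p => ⟨σ p.1.1 p.1.2, hG ▸ Set.mem_univ _⟩, ?_⟩, ?_⟩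
  · intro p q h
    exact Subtype.ext (hinj (Subtype.ext_iff.1 h))
  · rintro _ ⟨i, rfl⟩
    convert hg i using 1
    ext z
    constructor
    · rintro ⟨⟨⟨j, b⟩, hu⟩, hjb, rfl⟩
      have hjb' : j = i ∨ (j = i + 1 ∧ (b : ℕ) = 0) := hjb
      change σ j b ∈ g i
      rcases hjb' with rfl | ⟨rfl, hb⟩
      · exact (hmem _ b).1
      · have : b = ⟨0, by omega⟩ := Fin.ext hb
        rw [this, hσ0]
        exact hv' i
    · intro hz
      by_cases hzv : z = v (i + 1)
      · exact ⟨⟨(i + 1, ⟨0, by omega⟩), Set.mem_univ _⟩, Or.inr ⟨rfl, rfl⟩,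
          (hσ0 (i + 1)).trans hzv.symm⟩
      · have : z ∈ Set.range (σ i) := by
          rw [hσr]
          exact Finset.mem_coe.2 (Finset.mem_erase.2 ⟨hzv, hz⟩)
        obtain ⟨b, rfl⟩ := this
        exact ⟨⟨(i, b), Set.mem_univ _⟩, Or.inl rfl, rfl⟩

/-- A linear path of length at least three, closed by an edge that meets it in its two ends only,
is a linear cycle. -/
theorem containsCopy_linearCycle_of_path {V : Type*} [DecidableEq V] {G : Hypergraph V}
    (hG : G.vertexSet = Set.univ) {r m : ℕ} (hr : 2 ≤ r) {L : List (Finset V)} {a b : V}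
    {e : Finset V} (hp : IsLinearPath a L b) (hL : L.length + 1 = m) (hm : 3 ≤ m)
    (hmem : ∀ f ∈ L, (f : Set V) ∈ G.edgeSet ∧ f.card = r)
    (he : (e : Set V) ∈ G.edgeSet ∧ e.card = r)
    (hab : a ≠ b) (ha : a ∈ e) (hb : b ∈ e)
    (hint : ∀ f ∈ L, ∀ z ∈ e, z ∈ f → z = a ∨ z = b) :
    G.ContainsCopy (linearCycle r m) := by
  have : NeZero m := ⟨by omega⟩
  obtain ⟨v, hv0, hvL, hv, hvi⟩ := hp.exists_vertices
  have hone : (1 : ZMod m).val = 1 := ZMod.val_one'' (by omega)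
  have hsucc : ∀ i : ZMod m, i.val < L.length → (i + 1).val = i.val + 1 := by
    intro i hi
    rw [ZMod.val_add, hone, Nat.mod_eq_of_lt (by omega)]
  have hlast : ∀ i : ZMod m, i.val = L.length → i + 1 = 0 := by
    intro i hi
    rw [← ZMod.natCast_zmod_val i, hi]
    exact_mod_cast (by rw [hL]; exact ZMod.natCast_self m : ((L.length + 1 : ℕ) : ZMod m) = 0)
  have hlt : ∀ i : ZMod m, i.val < L.length ∨ i.val = L.length := by
    intro i
    have := ZMod.val_lt i
    omega
  have hext : ∀ i j : ZMod m, j.val = i.val + 1 → j = i + 1 := by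
    intro i j h
    rw [← ZMod.natCast_zmod_val j, h, Nat.cast_add, ZMod.natCast_zmod_val, Nat.cast_one]
  -- The closing edge takes the last index `L.length = m - 1`.
  let g : ZMod m → Finset V := fun i => if h : i.val < L.length then L[i.val] else e
  have hg1 : ∀ i : ZMod m, ∀ h : i.val < L.length, g i = L[i.val] := fun i h => dif_pos h
  have hg2 : ∀ i : ZMod m, i.val = L.length → g i = e := fun i h => dif_neg (by omega)
  have hgG : ∀ i, (g i : Set V) ∈ G.edgeSet ∧ (g i).card = r := by
    intro i
    rcases hlt i with h | h
    · rw [hg1 i h]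
      exact hmem _ (List.getElem_mem h)
    · rw [hg2 i h]
      exact he
  have key : ∀ i j : ZMod m, i.val < j.val → ∀ z ∈ g i, z ∈ g j →
      (j = i + 1 ∧ z = v j.val) ∨ (i = j + 1 ∧ z = v i.val) := by
    intro i j hij z hzi hzj
    rcases hlt j with h | h
    · rw [hg1 i (by omega)] at hzi
      rw [hg1 j h] at hzj
      obtain ⟨h1, h2⟩ := hvi _ _ (by omega) h hij z hzi hzj
      exact Or.inl ⟨hext i j h1, h2⟩
    · have hi : i.val < L.length := by omega
      rw [hg1 i hi] at hzi
      rw [hg2 j h] at hzj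
      -- The end `a` lies only in the first path edge and `b` only in the last; these are the cyclic
      -- neighbours of the closing edge.
      rcases hint _ (List.getElem_mem hi) z hzj hzi with hz | hz
      · right
        have hi0 : i.val = 0 := by
          by_contra hne
          obtain ⟨h1, h2⟩ := hvi 0 _ (by omega) hi (by omega) a (hv0 ▸ (hv 0 (by omega)).1)
            (hz ▸ hzi)
          apply (hv 0 (by omega)).2.2
          rw [hv0, h2, h1]
        refine ⟨?_, by rw [hi0, hv0, hz]⟩
        rw [hlast j h]
        exact (ZMod.val_eq_zero i).1 hi0
      · left
        have hi0 : i.val + 1 = L.length := by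
          by_contra hne
          have hl : L.length - 1 + 1 = L.length := by omega
          have hv' := hv (L.length - 1) (by omega)
          rw [hl, hvL] at hv'
          exact hv'.2.2 (hvi _ _ hi (by omega) (by omega) b (hz ▸ hzi) hv'.2.1).2.symm
        exact ⟨hext i j (by omega), by rw [h, hvL, hz]⟩
  refine containsCopy_linearCycle_of_zmod hG hr g (fun i => v i.val) (fun i => (hgG i).1)
    (fun i => (hgG i).2) ?_ ?_ ?_ ?_
  · intro i
    rcases hlt i with h | h
    · rw [hg1 i h]
      exact (hv _ h).1
    · rw [hg2 i h, h, hvL]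
      exact hb
  · intro i
    rcases hlt i with h | h
    · rw [hg1 i h, hsucc i h]
      exact (hv _ h).2.1
    · rw [hg2 i h, hlast i h, ZMod.val_zero, hv0]
      exact ha
  · intro i
    rcases hlt i with h | h
    · simp only [hsucc i h]
      exact (hv _ h).2.2
    · simp only [hlast i h, ZMod.val_zero, h, hv0, hvL]
      exact hab.symm
  · intro i j hij z hzi hzj
    rcases lt_trichotomy i.val j.val with h | h | h
    · exact key i j h z hzi hzj
    · exact absurd (ZMod.val_injective m h) hij
    · exact (key j i h z hzj hzi).symm

end Hypergraph

/-! ### Averaging lemmas and the greedy path. -/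

open Finset

/-- A family of more than `D * #S` nonempty subsets of `S` has a nonempty subfamily in which
every covered point has degree larger than `D`. -/
theorem exists_subfamily_degree_gt {ι V : Type*} [DecidableEq V] (inc : ι → Finset V) {D : ℝ}
    (hD : 0 ≤ D) (S : Finset V) (E : Finset ι) (hS : ∀ i ∈ E, inc i ⊆ S)
    (hE : D * #S < #E) :
    ∃ E' ⊆ E, E'.Nonempty ∧ ∀ i ∈ E', ∀ v ∈ inc i, D < #{j ∈ E' | v ∈ inc j} := by
  classical
  induction h : #S generalizing S E with
  | zero =>
    refine ⟨E, Subset.rfl, ?_, ?_⟩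
    · rw [← card_pos]
      exact_mod_cast (lt_of_le_of_lt (by positivity) hE : (0 : ℝ) < #E)
    · intro i hi v hv
      have := hS i hi hv
      rw [card_eq_zero.1 h] at this
      simp at this
  | succ n ih =>
    by_cases hdeg : ∀ v ∈ S, D < #{j ∈ E | v ∈ inc j}
    · refine ⟨E, Subset.rfl, ?_, fun i hi v hv => hdeg v (hS i hi hv)⟩
      rw [← card_pos]
      exact_mod_cast (lt_of_le_of_lt (by positivity) hE : (0 : ℝ) < #E)
    -- Deleting a point of degree at most `D` loses at most `D` members and lowers `D * #S` by `D`,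
    -- so the hypothesis persists.
    · push Not at hdeg
      obtain ⟨v, hv, hle⟩ := hdeg
      have hcard : #(S.erase v) = n := by rw [card_erase_of_mem hv, h, Nat.add_sub_cancel]
      have hS' : ∀ i ∈ {j ∈ E | v ∉ inc j}, inc i ⊆ S.erase v := by
        intro i hi u hu
        rw [mem_filter] at hi
        exact mem_erase.2 ⟨fun h => hi.2 (h ▸ hu), hS i hi.1 hu⟩
      have hE' : D * #(S.erase v) < #{j ∈ E | v ∉ inc j} := by
        have h1 : (#{j ∈ E | v ∈ inc j} : ℝ) + #{j ∈ E | v ∉ inc j} = #E := by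
          exact_mod_cast card_filter_add_card_filter_not (s := E) (fun j => v ∈ inc j)
        rw [hcard]
        rw [h] at hE
        push_cast at hE
        linarith
      obtain ⟨E', hE', hne, hd⟩ := ih (S.erase v) {j ∈ E | v ∉ inc j} hS' hE' hcard
      exact ⟨E', hE'.trans (filter_subset _ _), hne, hd⟩

/-- Let `g 0, …, g l` be labellings of `N` such that `g l` is constant and no fibre of `g 0` has
more than half of the elements. Then for some `h` a quarter of the elements agree with some fixed
element in the label `g h`, but not in the label `g (h - 1)`. -/
theorem exists_split_level {ι β : Type*} [DecidableEq β] {N : Finset ι} (hN : N.Nonempty)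
    (g : ℕ → ι → β) (l : ℕ) (htop : ∀ i ∈ N, ∀ j ∈ N, g l i = g l j)
    (hbot : ∀ b, 2 * #{i ∈ N | g 0 i = b} ≤ #N) :
    ∃ i₀ ∈ N, ∃ h < l,
      #N ≤ 4 * #{i ∈ N | g (h + 1) i = g (h + 1) i₀ ∧ g h i ≠ g h i₀} := by
  classical
  -- The first level with a fibre `A` of more than half of `N` is `h + 1`; all fibres one level
  -- earlier have at most half.
  have hex : ∃ h, ∃ b, #N < 2 * #{i ∈ N | g h i = b} := by
    obtain ⟨i₀, hi₀⟩ := hN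
    refine ⟨l, g l i₀, ?_⟩
    rw [filter_true_of_mem fun i hi => htop i hi i₀ hi₀]
    have := card_pos.2 ⟨i₀, hi₀⟩
    omega
  have hmin := fun h => Nat.find_min hex (m := h)
  have hle : Nat.find hex ≤ l := by
    by_contra! hlt
    obtain ⟨i₀, hi₀⟩ := hN
    apply hmin l hlt
    refine ⟨g l i₀, ?_⟩
    rw [filter_true_of_mem fun i hi => htop i hi i₀ hi₀]
    have := card_pos.2 ⟨i₀, hi₀⟩
    omega
  obtain ⟨b, hb⟩ := Nat.find_spec hex
  obtain ⟨h, hh⟩ : ∃ h, Nat.find hex = h + 1 := by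
    apply Nat.exists_eq_succ_of_ne_zero
    intro h0
    rw [h0] at hb
    have := hbot b
    omega
  rw [hh] at hb hle
  have hsmall : ∀ c, 2 * #{i ∈ N | g h i = c} ≤ #N := by
    intro c
    by_contra! hc
    exact hmin h (by omega) ⟨c, hc⟩
  set A := {i ∈ N | g (h + 1) i = b} with hA
  have hAN : ∀ i₀ ∈ A, {i ∈ A | g h i ≠ g h i₀} =
      {i ∈ N | g (h + 1) i = g (h + 1) i₀ ∧ g h i ≠ g h i₀} := by
    intro i₀ hi₀
    rw [hA, filter_filter, (mem_filter.1 hi₀).2]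
  obtain ⟨i₁, hi₁⟩ : A.Nonempty := by
    rw [← card_pos]
    omega
  have hsplit := card_filter_add_card_filter_not (s := A) (fun i => g h i = g h i₁)
  by_cases h1 : #A ≤ 2 * #{i ∈ A | g h i ≠ g h i₁}
  · refine ⟨i₁, (mem_filter.1 hi₁).1, h, hle, ?_⟩
    rw [← hAN i₁ hi₁]
    omega
  -- Here more than half of `A` agrees with `i₁`. That fibre is too small to be all of `A`, and all
  -- of it disagrees with any `i₂` outside it.
  · obtain ⟨i₂, hi₂⟩ : {i ∈ A | g h i ≠ g h i₁}.Nonempty := by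
      rw [nonempty_iff_ne_empty]
      intro hemp
      have h2 : #{i ∈ A | g h i = g h i₁} ≤ #{i ∈ N | g h i = g h i₁} :=
        card_le_card (filter_subset_filter _ (filter_subset _ _))
      have h3 := hsmall (g h i₁)
      have h4 : #{i ∈ A | ¬ g h i = g h i₁} = 0 := card_eq_zero.2 hemp
      omega
    rw [mem_filter] at hi₂
    refine ⟨i₂, (mem_filter.1 hi₂.1).1, h, hle, ?_⟩
    rw [← hAN i₂ hi₂.1]
    have h5 : #{i ∈ A | g h i = g h i₁} ≤ #{i ∈ A | g h i ≠ g h i₂} := by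
      refine card_le_card fun i hi => ?_
      rw [mem_filter] at hi ⊢
      exact ⟨hi.1, fun h => hi₂.2 (h ▸ hi.2)⟩
    simp only [ne_eq] at *
    omega

/-- Every directed graph has a directed cut with a quarter of its edges. -/
theorem exists_directed_cut {ι β : Type*} [Fintype β] [DecidableEq β] (P : Finset ι) (f g : ι → β)
    (hfg : ∀ i ∈ P, f i ≠ g i) :
    ∃ c : β → Bool, #P ≤ 4 * #{i ∈ P | c (f i) = true ∧ c (g i) = false} := by
  -- A random colouring gives two distinct points the prescribed colours with probability `1 / 4`:
  -- forcing these colours is a map with fibres of size at most four.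
  have hquarter : ∀ b b' : β, b ≠ b' →
      Fintype.card (β → Bool) ≤ 4 * #{c : β → Bool | c b = true ∧ c b' = false} := by
    intro b b' hbb
    rw [← card_univ]
    refine card_le_mul_card_image_of_maps_to
      (f := fun c => Function.update (Function.update c b true) b' false) ?_ 4 ?_
    · intro c _
      simp [Function.update_of_ne hbb]
    · intro d _
      refine (card_le_card_of_injOn (t := (univ : Finset (Bool × Bool))) (fun c => (c b, c b'))
        (by simp) ?_).trans (by simp)
      intro c hc c' hc' h
      simp only [coe_filter, mem_univ, true_and, Set.mem_ofPred_eq] at hc hc'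
      simp only [Prod.mk.injEq] at h
      funext y
      by_cases hy' : y = b'
      · rw [hy', h.2]
      by_cases hy : y = b
      · rw [hy, h.1]
      have := congrFun (hc.trans hc'.symm) y
      simpa [Function.update_of_ne hy', Function.update_of_ne hy] using this
  by_contra! hlt
  have h1 : ∑ c : β → Bool, 4 * #{i ∈ P | c (f i) = true ∧ c (g i) = false} <
      ∑ _c : β → Bool, #P := sum_lt_sum_of_nonempty univ_nonempty fun c _ => hlt c
  have h2 : ∑ c : β → Bool, #{i ∈ P | c (f i) = true ∧ c (g i) = false} =
      ∑ i ∈ P, #{c : β → Bool | c (f i) = true ∧ c (g i) = false} := by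
    simp only [card_filter]
    exact sum_comm
  rw [← mul_sum, h2, mul_sum, sum_const, card_univ, smul_eq_mul] at h1
  have h3 : ∑ _i ∈ P, Fintype.card (β → Bool) ≤
      ∑ i ∈ P, 4 * #{c : β → Bool | c (f i) = true ∧ c (g i) = false} :=
    sum_le_sum fun i hi => hquarter _ _ (hfg i hi)
  rw [sum_const, smul_eq_mul, mul_comm] at h3
  omega

/-- The edges of a list cover at most `length * r` points. -/
theorem card_biUnion_toFinset_le {V : Type*} [DecidableEq V] {r : ℕ} (L : List (Finset V))
    (h : ∀ f ∈ L, #f ≤ r) : #(L.toFinset.biUnion id) ≤ L.length * r := by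
  refine (card_biUnion_le_card_mul _ _ r fun f hf => h f (List.mem_toFinset.1 hf)).trans ?_
  exact Nat.mul_le_mul_right _ (List.toFinset_card_le L)

/-- Greedy construction of linear paths in a family of edges with two marked vertices each, the
consecutive joints being marked of kind `x` and of kind `w` alternately. -/
theorem exists_greedy_linearPath {V : Type*} [DecidableEq V] {P : Finset (Finset V)}
    {x w : Finset V → V} {q : V → Finset V} {r D : ℕ} {Z : Finset V} (hr : 1 ≤ r)
    (hlin : ∀ e ∈ P, ∀ f ∈ P, e ≠ f → #(e ∩ f) ≤ 1) (hcard : ∀ e ∈ P, #e ≤ r)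
    (hx : ∀ e ∈ P, x e ∈ e) (hw : ∀ e ∈ P, w e ∈ e) (hne : ∀ e ∈ P, x e ≠ w e)
    (hdx : ∀ e ∈ P, D < #{f ∈ P | x f = x e}) (hdw : ∀ e ∈ P, D < #{f ∈ P | w f = w e})
    (hq : ∀ y z, #{f ∈ P | x f = y ∧ z ∈ q (w f)} ≤ r - 1)
    (hqf : ∀ f ∈ P, ∀ z ∈ f, z ∈ q (w f) → z = w f)
    {e₁ : Finset V} (he₁ : e₁ ∈ P) (hZ : x e₁ ∉ Z) (s : ℕ) (hD : r * (#Z + (2 * s + 1) * r) ≤ D) :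
    ∃ L : List (Finset V), ∃ e ∈ P, L.length = 2 * s + 1 ∧ (∀ f ∈ L, f ∈ P) ∧
      IsLinearPath (x e₁) L (w e) ∧ (∀ f ∈ L, Disjoint f Z) ∧ (∀ z ∈ Z, z ∉ q (w e)) ∧
      ∀ f ∈ L, ∀ z ∈ f, z ∈ q (w e) → z = w e := by
  have hpair : ∀ y z, y ≠ z → #{f ∈ P | y ∈ f ∧ z ∈ f} ≤ 1 := by
    intro y z hyz
    rw [card_le_one]
    intro e he f hf
    rw [mem_filter] at he hf
    by_contra hef
    exact hyz (card_le_one.1 (hlin e he.1 f hf.1 hef) y (mem_inter.2 ⟨he.2.1, hf.2.1⟩) z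
      (mem_inter.2 ⟨he.2.2, hf.2.2⟩))
  -- Each forbidden point excludes at most `r` edges: one through it and `x e`, and `r - 1` by `hq`.
  have xstep : ∀ e ∈ P, ∀ Z' : Finset V, x e ∉ Z' → r * #Z' ≤ D →
      ∃ f ∈ P, x f = x e ∧ Disjoint f Z' ∧ ∀ z ∈ Z', z ∉ q (w f) := by
    intro e he Z' heZ hD'
    by_contra! hcon
    have hsub : {f ∈ P | x f = x e} ⊆ Z'.biUnion fun z =>
        {f ∈ P | x e ∈ f ∧ z ∈ f} ∪ {f ∈ P | x f = x e ∧ z ∈ q (w f)} := by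
      intro f hf
      rw [mem_filter] at hf
      by_cases hdis : Disjoint f Z'
      · obtain ⟨z, hz, hzq⟩ := hcon f hf.1 hf.2 hdis
        exact mem_biUnion.2 ⟨z, hz, mem_union_right _ (mem_filter.2 ⟨hf.1, hf.2, hzq⟩)⟩
      · obtain ⟨z, hzf, hz⟩ := not_disjoint_iff.1 hdis
        exact mem_biUnion.2 ⟨z, hz, mem_union_left _
          (mem_filter.2 ⟨hf.1, hf.2 ▸ hx f hf.1, hzf⟩)⟩
    have hle := (card_le_card hsub).trans (card_biUnion_le_card_mul _ _ r fun z hz => by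
      refine (card_union_le _ _).trans ?_
      have h1 := hpair (x e) z (fun h => heZ (h ▸ hz))
      have h2 := hq (x e) z
      omega)
    have := hdx e he
    rw [mul_comm] at hle
    omega
  have wstep : ∀ e ∈ P, ∀ Z' : Finset V, w e ∉ Z' → #Z' ≤ D →
      ∃ f ∈ P, w f = w e ∧ Disjoint f Z' := by
    intro e he Z' heZ hD'
    by_contra! hcon
    have hsub : {f ∈ P | w f = w e} ⊆ Z'.biUnion fun z => {f ∈ P | w e ∈ f ∧ z ∈ f} := by
      intro f hf
      rw [mem_filter] at hf
      obtain ⟨z, hzf, hz⟩ := not_disjoint_iff.1 (hcon f hf.1 hf.2)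
      exact mem_biUnion.2 ⟨z, hz, mem_filter.2 ⟨hf.1, hf.2 ▸ hw f hf.1, hzf⟩⟩
    have hle := (card_le_card hsub).trans (card_biUnion_le_card_mul _ _ 1 fun z hz =>
      hpair (w e) z (fun h => heZ (h ▸ hz)))
    have := hdw e he
    omega
  induction s with
  | zero =>
    obtain ⟨f, hf, hxf, hdis, hqz⟩ := xstep e₁ he₁ Z hZ
      ((Nat.mul_le_mul_left _ (Nat.le_add_right _ _)).trans hD)
    refine ⟨[f], f, hf, rfl, by simpa using hf, ?_, by simpa using hdis, hqz, by simpa using hqf f hf⟩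
    exact IsLinearPath.singleton (hxf ▸ hx f hf) (hw f hf) (hxf ▸ hne f hf)
  | succ s ih =>
    -- The conditions on `q` concern only the last edge, so they are dropped here and established
    -- anew after two more steps.
    obtain ⟨L, e, he, hlen, hLP, hpath, hLZ, -, -⟩ :=
      ih (le_trans (Nat.mul_le_mul_left _ (by gcongr; omega)) hD)
    have hD1 : #Z + (2 * s + 1) * r + r ≤ D := by
      refine le_trans ?_ hD
      calc #Z + (2 * s + 1) * r + r ≤ 1 * (#Z + (2 * (s + 1) + 1) * r) := by nlinarith
        _ ≤ _ := Nat.mul_le_mul_right _ hr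
    have hD2 : r * (#Z + ((2 * s + 1) * r + r)) ≤ D := by
      refine le_trans (Nat.mul_le_mul_left _ ?_) hD
      nlinarith
    set U := L.toFinset.biUnion id with hU
    have hUmem : ∀ f ∈ L, ∀ z ∈ f, z ∈ U := fun f hf z hz =>
      mem_biUnion.2 ⟨f, List.mem_toFinset.2 hf, hz⟩
    have hUcard : #U ≤ (2 * s + 1) * r := by
      rw [← hlen]
      exact card_biUnion_toFinset_le L fun f hf => hcard f (hLP f hf)
    have hweZ : w e ∉ Z := by
      obtain ⟨f, hf, hwf⟩ := hpath.exists_end_mem (by intro h; simp [h] at hlen)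
      exact fun h => disjoint_left.1 (hLZ f hf) hwf h
    obtain ⟨f, hf, hwf, hfdis⟩ := wstep e he (Z ∪ U.erase (w e))
      (by simp [hweZ]) (by
        refine (card_union_le _ _).trans ?_
        have := card_erase_le (s := U) (a := w e)
        omega)
    rw [disjoint_union_right] at hfdis
    have hpath1 : IsLinearPath (x e₁) (L ++ [f]) (x f) := by
      refine hpath.append (IsLinearPath.singleton (hwf ▸ hw f hf) (hx f hf) ?_) ?_
      · exact hwf ▸ (hne f hf).symm
      · intro g hg g' hg' z hz hz'
        rw [List.mem_singleton.1 hg'] at hz'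
        by_contra hzw
        exact disjoint_left.1 hfdis.2 hz' (mem_erase.2 ⟨hzw, hUmem g hg z hz⟩)
    obtain ⟨f', hf', hxf', hfdis', hfq⟩ := xstep f hf (Z ∪ (U ∪ f).erase (x f))
      (by simpa using fun h => disjoint_left.1 hfdis.1 (hx f hf) h) (by
        refine (Nat.mul_le_mul_left _ ?_).trans hD2
        refine (card_union_le _ _).trans ?_
        have h1 := card_erase_le (s := U ∪ f) (a := x f)
        have h2 := card_union_le U f
        have h3 := hcard f hf
        omega)
    rw [disjoint_union_right] at hfdis'
    have hmem : ∀ g ∈ L ++ [f], ∀ z ∈ g, z ≠ x f → z ∈ (U ∪ f).erase (x f) := by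
      intro g hg z hz hzx
      rw [mem_erase, mem_union]
      refine ⟨hzx, ?_⟩
      rcases List.mem_append.1 hg with hg | hg
      · exact Or.inl (hUmem g hg z hz)
      · exact Or.inr (List.mem_singleton.1 hg ▸ hz)
    refine ⟨L ++ [f] ++ [f'], f', hf', by simp [hlen]; omega, ?_, ?_, ?_, ?_, ?_⟩
    · intro g hg
      simp only [List.append_assoc, List.mem_append, List.mem_singleton] at hg
      rcases hg with hg | rfl | rfl
      exacts [hLP g hg, hf, hf']
    · refine hpath1.append (IsLinearPath.singleton (hxf' ▸ hx f' hf') (hw f' hf') ?_) ?_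
      · exact hxf' ▸ hne f' hf'
      · intro g hg g' hg' z hz hz'
        rw [List.mem_singleton.1 hg'] at hz'
        by_contra hzw
        exact disjoint_left.1 hfdis'.2 hz' (hmem g hg z hz hzw)
    · intro g hg
      simp only [List.append_assoc, List.mem_append, List.mem_singleton] at hg
      rcases hg with hg | rfl | rfl
      exacts [hLZ g hg, hfdis.1, hfdis'.1]
    · exact fun z hz => hfq z (mem_union_left _ hz)
    · intro g hg z hz hzq
      rcases List.mem_append.1 hg with hg | hg
      · by_cases hzx : z = x f
        · exact hqf f' hf' z (by rw [hzx, ← hxf']; exact hx f' hf') hzq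
        · exact absurd hzq (hfq z (mem_union_right _ (hmem g hg z hz hzx)))
      · rw [List.mem_singleton.1 hg] at hz
        exact hqf f' hf' z hz hzq

/-! ### Linear trees and their paths towards the root. -/

/-- A rooted linear tree of height `J` with edges in `E`. The vertices of the tree are those of
level at most `J`. A vertex `v` of positive level lies in a unique edge `pe v` towards the root,
which it leaves through the vertex `par v`; all other vertices of this edge are siblings of `v`.
Each edge has exactly one vertex other than its parent, the spine vertex, through which the tree may
be continued. -/
structure LinearTree {V : Type*} (E : Finset (Finset V)) (J : ℕ) where
  lev : V → ℕ
  pe : V → Finset V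
  par : V → V
  spine : Finset V
  root : V
  lev_root : lev root = 0
  root_mem_spine : root ∈ spine
  eq_root : ∀ v, lev v = 0 → v = root
  pe_mem : ∀ v, 1 ≤ lev v → lev v ≤ J → pe v ∈ E
  mem_pe : ∀ v, 1 ≤ lev v → lev v ≤ J → v ∈ pe v
  par_mem_pe : ∀ v, 1 ≤ lev v → lev v ≤ J → par v ∈ pe v
  lev_par : ∀ v, 1 ≤ lev v → lev v ≤ J → lev (par v) + 1 = lev v
  par_mem_spine : ∀ v, 1 ≤ lev v → lev v ≤ J → par v ∈ spine
  sibling : ∀ v, 1 ≤ lev v → lev v ≤ J → ∀ z ∈ pe v, z ≠ par v →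
    pe z = pe v ∧ par z = par v ∧ lev z = lev v
  exists_spine : ∀ v, 1 ≤ lev v → lev v ≤ J → ∃ u ∈ spine, pe u = pe v ∧ lev u = lev v
  spine_inj : ∀ u ∈ spine, ∀ v ∈ spine, 1 ≤ lev u → lev u ≤ J → 1 ≤ lev v → lev v ≤ J →
    pe u = pe v → u = v

namespace LinearTree

variable {V : Type*} {E : Finset (Finset V)} {J : ℕ} (T : LinearTree E J)

/-- The edges of the path of length `h` from a vertex towards the root. -/
def up (T : LinearTree E J) : ℕ → V → List (Finset V)
  | 0, _ => []
  | h + 1, v => T.pe v :: T.up h (T.par v)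

theorem length_up (h : ℕ) (v : V) : (T.up h v).length = h := by
  induction h generalizing v with
  | zero => rfl
  | succ h ih => simp [up, ih]

theorem mem_up {h : ℕ} {v : V} {f : Finset V} :
    f ∈ T.up h v ↔ ∃ i < h, f = T.pe (T.par^[i] v) := by
  induction h generalizing v with
  | zero => simp [up]
  | succ h ih =>
    rw [up, List.mem_cons, ih]
    constructor
    · rintro (rfl | ⟨i, hi, rfl⟩)
      · exact ⟨0, by omega, rfl⟩
      · exact ⟨i + 1, by omega, rfl⟩
    · rintro ⟨_ | i, hi, rfl⟩
      · exact Or.inl rfl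
      · exact Or.inr ⟨i, by omega, rfl⟩

theorem lev_iterate {v : V} (hv : T.lev v ≤ J) {i : ℕ} (hi : i ≤ T.lev v) :
    T.lev (T.par^[i] v) + i = T.lev v := by
  induction i with
  | zero => rfl
  | succ i ih =>
    have h := ih (by omega)
    rw [Function.iterate_succ_apply']
    have := T.lev_par (T.par^[i] v) (by omega) (by omega)
    omega

/-- Every vertex of the path except its top is charged to the edge in which it is not the parent;
its level then determines the index of that edge. -/
theorem mem_up_cases {h : ℕ} {v : V} (hv : T.lev v ≤ J) (hh : h ≤ T.lev v) {f : Finset V}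
    (hf : f ∈ T.up h v) {z : V} (hz : z ∈ f) :
    z = T.par^[h] v ∨ ∃ i < h, T.lev z + i = T.lev v ∧ T.pe z = T.pe (T.par^[i] v) := by
  obtain ⟨i, hi, rfl⟩ := T.mem_up.1 hf
  have hl := T.lev_iterate hv (i := i) (by omega)
  by_cases hzp : z = T.par (T.par^[i] v)
  · rw [← Function.iterate_succ_apply' T.par] at hzp
    by_cases hih : i + 1 = h
    · exact Or.inl (hih ▸ hzp)
    · refine Or.inr ⟨i + 1, by omega, ?_, by rw [hzp]⟩
      rw [hzp]
      exact T.lev_iterate hv (by omega)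
  · obtain ⟨h1, -, h3⟩ := T.sibling _ (by omega) (by omega) z hz hzp
    exact Or.inr ⟨i, hi, by omega, h1⟩

theorem lev_le_of_mem_up {h : ℕ} {v : V} (hv : T.lev v ≤ J) (hh : h ≤ T.lev v) {f : Finset V}
    (hf : f ∈ T.up h v) {z : V} (hz : z ∈ f) : T.lev z ≤ T.lev v := by
  rcases T.mem_up_cases hv hh hf hz with rfl | ⟨i, -, h1, -⟩
  · have := T.lev_iterate hv hh
    omega
  · omega

theorem mem_pe_of_mem_up {h : ℕ} {v : V} (hv : T.lev v ≤ J) (hh : h ≤ T.lev v) {f : Finset V}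
    (hf : f ∈ T.up h v) {z : V} (hz : z ∈ f) (hlev : T.lev v ≤ T.lev z) : z ∈ T.pe v := by
  obtain ⟨j, hj, -⟩ := T.mem_up.1 hf
  rcases T.mem_up_cases hv hh hf hz with rfl | ⟨i, hi, h1, h2⟩
  · have := T.lev_iterate hv hh
    omega
  · obtain rfl : i = 0 := by omega
    rw [Function.iterate_zero_apply] at h2
    exact h2 ▸ T.mem_pe z (by omega) (by omega)

theorem par_eq_of_pe_eq {u v : V} (hu : 1 ≤ T.lev u) (hu' : T.lev u ≤ J) (hv : 1 ≤ T.lev v)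
    (hv' : T.lev v ≤ J) (h : T.pe u = T.pe v) : T.par u = T.par v := by
  have huv := h ▸ T.mem_pe u hu hu'
  have hvu := h ▸ T.mem_pe v hv hv'
  by_cases h1 : u = T.par v
  · have h2 := T.lev_par v hv hv'
    rw [← h1] at h2
    by_cases h3 : v = T.par u
    · have h4 := T.lev_par u hu hu'
      rw [← h3] at h4
      omega
    · have := (T.sibling u hu hu' v hvu h3).2.2
      omega
  · exact (T.sibling v hv hv' u huv h1).2.1

theorem isLinearPath_up {h : ℕ} {v : V} (hv : T.lev v ≤ J) (hh : h ≤ T.lev v) :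
    IsLinearPath v (T.up h v) (T.par^[h] v) := by
  induction h generalizing v with
  | zero => exact rfl
  | succ h ih =>
    have hl := T.lev_par v (by omega) hv
    refine ⟨T.par v, T.mem_pe v (by omega) hv, T.par_mem_pe v (by omega) hv, ?_, ?_,
      ih (by omega) (by omega)⟩
    · intro heq
      rw [← heq] at hl
      omega
    · intro f hf z hz hzf
      by_contra hne
      have h1 := (T.sibling v (by omega) hv z hz hne).2.2
      have h2 := T.lev_le_of_mem_up (by omega) (by omega) hf hzf
      omega

/-- By levels, a common vertex below the top sits in edges of equal index on both paths. These edges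
would coincide, hence so would all later ones, against `hne`. -/
theorem eq_of_mem_up_of_mem_up {h l : ℕ} {u v : V} (hu : T.lev u = l) (hv : T.lev v = l)
    (hl : l ≤ J) (hh : h < l) (heq : T.par^[h + 1] u = T.par^[h + 1] v)
    (hne : T.pe (T.par^[h] u) ≠ T.pe (T.par^[h] v)) {f f' : Finset V} (hf : f ∈ T.up (h + 1) u)
    (hf' : f' ∈ T.up (h + 1) v) {z : V} (hz : z ∈ f) (hz' : z ∈ f') : z = T.par^[h + 1] u := by
  rcases T.mem_up_cases (by omega) (by omega) hf hz with h1 | ⟨i, hi, h1, h2⟩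
  · exact h1
  rcases T.mem_up_cases (by omega) (by omega) hf' hz' with h3 | ⟨j, hj, h3, h4⟩
  · rw [h3, heq]
  exfalso
  obtain rfl : i = j := by omega
  rw [h2] at h4
  have hpar : ∀ d, T.par^[i + 1 + d] u = T.par^[i + 1 + d] v := by
    intro d
    rw [add_comm, Function.iterate_add_apply, Function.iterate_add_apply _ d,
      Function.iterate_succ_apply', Function.iterate_succ_apply']
    congr 1
    have h5 := T.lev_iterate (v := u) (i := i) (by omega) (by omega)
    have h6 := T.lev_iterate (v := v) (i := i) (by omega) (by omega)
    exact T.par_eq_of_pe_eq (by omega) (by omega) (by omega) (by omega) h4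
  apply hne
  rcases Nat.eq_or_lt_of_le (Nat.le_of_lt_succ hi) with rfl | hlt
  · exact h4
  · have := hpar (h - i - 1)
    rw [show i + 1 + (h - i - 1) = h by omega] at this
    rw [this]

theorem iterate_lev_eq_root {v : V} (hv : T.lev v ≤ J) : T.par^[T.lev v] v = T.root := by
  apply T.eq_root
  have := T.lev_iterate hv le_rfl
  omega

/-- Iterated parents are spine vertices, and an edge has only one besides its own parent. At level
`0` the value of `pe` carries no information, and uniqueness of the root is used instead. -/
theorem iterate_eq_of_pe_eq {h l : ℕ} {u v : V} (hu : T.lev u = l) (hv : T.lev v = l)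
    (hl : l ≤ J) (hh : h < l) (heq : T.pe (T.par^[h + 1] u) = T.pe (T.par^[h + 1] v)) :
    T.par^[h + 1] u = T.par^[h + 1] v := by
  have h1 := T.lev_iterate (v := u) (i := h + 1) (by omega) (by omega)
  have h2 := T.lev_iterate (v := v) (i := h + 1) (by omega) (by omega)
  rcases Nat.eq_or_lt_of_le (Nat.succ_le_of_lt hh) with h3 | h3
  · rw [T.eq_root (T.par^[h + 1] u) (by omega), T.eq_root (T.par^[h + 1] v) (by omega)]
  · have h4 := T.lev_iterate (v := u) (i := h) (by omega) (by omega)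
    have h5 := T.lev_iterate (v := v) (i := h) (by omega) (by omega)
    refine T.spine_inj _ ?_ _ ?_ (by omega) (by omega) (by omega) (by omega) heq
    · rw [Function.iterate_succ_apply']
      exact T.par_mem_spine _ (by omega) (by omega)
    · rw [Function.iterate_succ_apply']
      exact T.par_mem_spine _ (by omega) (by omega)

end LinearTree

/-! ### Cycles from dense families of edges on a tree. -/

namespace LinearTree

variable {V : Type*} [DecidableEq V] {E : Finset (Finset V)} {J : ℕ} (T : LinearTree E J)

theorem eq_of_mem_inter (hlin : ∀ e ∈ E, ∀ f ∈ E, e ≠ f → #(e ∩ f) ≤ 1) {e f : Finset V}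
    (he : e ∈ E) (hf : f ∈ E) (hef : e ≠ f) {y z : V} (hye : y ∈ e) (hyf : y ∈ f) (hze : z ∈ e)
    (hzf : z ∈ f) : y = z :=
  card_le_one.1 (hlin e he f hf hef) y (mem_inter.2 ⟨hye, hyf⟩) z (mem_inter.2 ⟨hze, hzf⟩)

/-- The parent of `v` lies below all of `e`, so `e` differs from `pe v` and linearity applies. -/
theorem eq_of_mem_pe (hlin : ∀ e ∈ E, ∀ f ∈ E, e ≠ f → #(e ∩ f) ≤ 1) {e : Finset V} (he : e ∈ E)
    {v z : V} (hv : 1 ≤ T.lev v) (hv' : T.lev v ≤ J) (hve : v ∈ e)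
    (hlev : ∀ y ∈ e, T.lev v ≤ T.lev y) (hz : z ∈ e) (hzv : z ∈ T.pe v) : z = v := by
  refine eq_of_mem_inter hlin he (T.pe_mem v hv hv') ?_ hz hzv hve (T.mem_pe v hv hv')
  rintro rfl
  have h1 := hlev _ (T.par_mem_pe v hv hv')
  have h2 := T.lev_par v hv hv'
  omega

/-- A family of edges of large minimum degree, in which the path from the marked vertex `w e` of
minimal level `l` to the root always meets the path from a vertex `w₀` exactly `h + 1` levels up,
gives rise to a linear cycle of length `2 * k`, closed by an edge through `w₀` and `x e₁`. -/
theorem containsCopy_of_degree_gt (hlin : ∀ e ∈ E, ∀ f ∈ E, e ≠ f → #(e ∩ f) ≤ 1) {r k h l : ℕ}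
    (hcard : ∀ e ∈ E, #e = r) (hr : 2 ≤ r) {G : Hypergraph V} (hG : G.vertexSet = Set.univ)
    (hEG : ∀ e ∈ E, (e : Set V) ∈ G.edgeSet) (hhl : h < l) (hlk : l < k) (hlJ : l ≤ J)
    {x w : Finset V → V} {P : Finset (Finset V)} (hPE : P ⊆ E) (hx : ∀ e ∈ P, x e ∈ e)
    (hw : ∀ e ∈ P, w e ∈ e) (hne : ∀ e ∈ P, x e ≠ w e) (hwl : ∀ e ∈ P, T.lev (w e) = l)
    (hmin : ∀ e ∈ P, ∀ z ∈ e, l ≤ T.lev z)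
    (hdx : ∀ e ∈ P, 2 * k * r * r < #{f ∈ P | x f = x e})
    (hdw : ∀ e ∈ P, 2 * k * r * r < #{f ∈ P | w f = w e})
    {e₁ e₀ : Finset V} {w₀ : V} (he₁ : e₁ ∈ P) (he₀ : e₀ ∈ E) (hx₀ : x e₁ ∈ e₀) (hw₀ : w₀ ∈ e₀)
    (hne₀ : x e₁ ≠ w₀) (hw₀l : T.lev w₀ = l) (hmin₀ : ∀ z ∈ e₀, l ≤ T.lev z)
    (htop : ∀ e ∈ P, T.par^[h + 1] (w e) = T.par^[h + 1] w₀)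
    (hbranch : ∀ e ∈ P, T.pe (T.par^[h] (w e)) ≠ T.pe (T.par^[h] w₀)) :
    G.ContainsCopy (Hypergraph.linearCycle r (2 * k)) := by
  set U₀ := (T.up (h + 1) w₀).toFinset.biUnion id with hU₀
  -- The greedy path must avoid the closing edge and the descent to `w₀`, except at its starting
  -- point.
  set Z := (e₀ ∪ U₀).erase (x e₁) with hZdef
  have hUE : ∀ {u : V}, T.lev u = l → ∀ f ∈ T.up (h + 1) u, f ∈ E := by
    intro u hu f hf
    obtain ⟨i, hi, rfl⟩ := T.mem_up.1 hf
    have := T.lev_iterate (v := u) (i := i) (by omega) (by omega)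
    exact T.pe_mem _ (by omega) (by omega)
  have hZcard : #Z ≤ r + (h + 1) * r := by
    refine card_erase_le.trans ((card_union_le _ _).trans (add_le_add (hcard _ he₀).le ?_))
    refine (card_biUnion_toFinset_le _ fun f hf => (hcard f (hUE hw₀l f hf)).le).trans ?_
    rw [length_up]
  have hmemZ₀ : ∀ z ∈ e₀, z ≠ x e₁ → z ∈ Z := fun z hz hzx =>
    mem_erase.2 ⟨hzx, mem_union_left _ hz⟩
  have hw₀eq : ∀ z ∈ e₀, z ∈ T.pe w₀ → z = w₀ := fun z hz hz' =>
    T.eq_of_mem_pe hlin he₀ (by omega) (by omega) hw₀ (fun y hy => hw₀l ▸ hmin₀ y hy) hz hz'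
  have hx₀U : ∀ f ∈ T.up (h + 1) w₀, x e₁ ∉ f := by
    intro f hf hxf
    exact hne₀ (hw₀eq _ hx₀ (T.mem_pe_of_mem_up (by omega) (by omega) hf hxf
      (hw₀l ▸ hmin₀ _ hx₀)))
  have hmemZU : ∀ f ∈ T.up (h + 1) w₀, ∀ z ∈ f, z ∈ Z := fun f hf z hz =>
    mem_erase.2 ⟨fun hzx => hx₀U f hf (hzx ▸ hz),
      mem_union_right _ (mem_biUnion.2 ⟨f, List.mem_toFinset.2 hf, hz⟩)⟩
  -- The greedy path stays at levels at least `l`, so it can meet the climb from `w e` only in the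
  -- level-`l` vertices of `pe (w e)`, which form `q (w e)`. The value `s = k - h - 2` makes the
  -- total length `(2 * s + 1) + 2 * (h + 1) + 1 = 2 * k`.
  obtain ⟨L, e, he, hlen, hLP, hpath, hLZ, hZq, hLq⟩ := exists_greedy_linearPath
    (q := fun v => {z ∈ T.pe v | T.lev z = l}) (r := r) (D := 2 * k * r * r) (Z := Z)
    (by omega) (fun e he f hf => hlin e (hPE he) f (hPE hf)) (fun e he => (hcard e (hPE he)).le)
    hx hw hne hdx hdw (by
      intro y z
      by_cases hz : T.lev z = l
      · have hcz : #((T.pe z).erase (T.par z)) = r - 1 := by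
          rw [card_erase_of_mem (T.par_mem_pe z (by omega) (by omega)),
            hcard _ (T.pe_mem z (by omega) (by omega))]
        rw [← hcz]
        -- Edges with the same `x` have different `w` by linearity, and each `w f` is a non-parent
        -- vertex of `pe z`.
        refine card_le_card_of_injOn w ?_ ?_
        · intro f hf
          simp only [mem_filter, coe_filter, Set.mem_ofPred_eq] at hf
          have hwf := hwl f hf.1
          have hzp : z ≠ T.par (w f) := by
            rintro rfl
            have := T.lev_par (w f) (by omega) (by omega)
            omega
          obtain ⟨h1, h2, -⟩ := T.sibling (w f) (by omega) (by omega) z hf.2.2.1 hzp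
          rw [mem_coe, mem_erase, h1, h2]
          refine ⟨?_, T.mem_pe _ (by omega) (by omega)⟩
          intro heq
          have := T.lev_par (w f) (by omega) (by omega)
          rw [← heq] at this
          omega
        · intro f hf f' hf' hff
          simp only [coe_filter, Set.mem_ofPred_eq] at hf hf'
          by_contra hneq
          refine hne f hf.1 (eq_of_mem_inter hlin (hPE hf.1) (hPE hf'.1) hneq (hx f hf.1) ?_
            (hw f hf.1) (hff ▸ hw f' hf'.1))
          rw [hf.2.1, ← hf'.2.1]
          exact hx f' hf'.1
      · rw [filter_false_of_mem]
        · simp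
        · intro f _ hf
          exact hz (mem_filter.1 hf.2).2)
    (by
      intro f hf z hz hzq
      have := hwl f hf
      exact T.eq_of_mem_pe hlin (hPE hf) (by omega) (by omega) (hw f hf)
        (fun y hy => this ▸ hmin f hf y hy) hz (mem_filter.1 hzq).1)
    he₁ (notMem_erase _ _) (k - h - 2) (by
      calc r * (#Z + (2 * (k - h - 2) + 1) * r)
          ≤ r * (r + (h + 1) * r + (2 * (k - h - 2) + 1) * r) := by gcongr
        _ = (1 + (h + 1) + (2 * (k - h - 2) + 1)) * r * r := by ring
        _ ≤ 2 * k * r * r := by gcongr; omega)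
  have hel := hwl e he
  have hmem_pe : ∀ f ∈ T.up (h + 1) (w e), ∀ z ∈ f, l ≤ T.lev z →
      z ∈ ({z ∈ T.pe (w e) | T.lev z = l} : Finset V) := by
    intro f hf z hz hzl
    have h1 := T.mem_pe_of_mem_up (by omega) (by omega) hf hz (by omega)
    have h2 := T.lev_le_of_mem_up (by omega) (by omega) hf hz
    exact mem_filter.2 ⟨h1, by omega⟩
  have hup : IsLinearPath (w e) (T.up (h + 1) (w e) ++ (T.up (h + 1) w₀).reverse) w₀ := by
    refine (T.isLinearPath_up (by omega) (by omega)).append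
      (htop e he ▸ (T.isLinearPath_up (v := w₀) (h := h + 1) (by omega) (by omega)).reverse) ?_
    intro f hf f' hf' z hz hz'
    exact T.eq_of_mem_up_of_mem_up hel hw₀l hlJ hhl (htop e he) (hbranch e he) hf
      (List.mem_reverse.1 hf') hz hz'
  refine Hypergraph.containsCopy_linearCycle_of_path hG hr (e := e₀) (hpath.append hup ?_) ?_
    (by omega) ?_ ⟨hEG _ he₀, hcard _ he₀⟩ hne₀ hx₀ hw₀ ?_
  · intro f hf f' hf' z hz hz'
    rw [List.mem_append, List.mem_reverse] at hf'
    rcases hf' with hf' | hf'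
    · exact hLq f hf z hz (hmem_pe f' hf' z hz' (hmin f (hLP f hf) z hz))
    · exact absurd (hmemZU f' hf' z hz') (disjoint_left.1 (hLZ f hf) hz)
  · simp only [List.length_append, List.length_reverse, length_up, hlen]
    omega
  · intro f hf
    have hfE : f ∈ E := by
      simp only [List.mem_append, List.mem_reverse] at hf
      rcases hf with hf | hf | hf
      exacts [hPE (hLP f hf), hUE hel f hf, hUE hw₀l f hf]
    exact ⟨hEG f hfE, hcard f hfE⟩
  · intro f hf z hz hzf
    simp only [List.mem_append, List.mem_reverse] at hf
    by_contra! hcon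
    rcases hf with hf | hf | hf
    · exact disjoint_left.1 (hLZ f hf) hzf (hmemZ₀ z hz hcon.1)
    · exact hZq z (hmemZ₀ z hz hcon.1) (hmem_pe f hf z hzf (hmin₀ z hz))
    · exact hcon.2 (hw₀eq z hz (T.mem_pe_of_mem_up (by omega) (by omega) hf hzf
        (hw₀l ▸ hmin₀ z hz)))

/-- The number of edges diverging exactly `h + 1` levels up from the designated edges. -/
theorem card_le_of_not_containsCopy [Fintype V]
    (hlin : ∀ e ∈ E, ∀ f ∈ E, e ≠ f → #(e ∩ f) ≤ 1) {r k h l : ℕ}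
    (hcard : ∀ e ∈ E, #e = r) (hr : 2 ≤ r) {G : Hypergraph V} (hG : G.vertexSet = Set.univ)
    (hEG : ∀ e ∈ E, (e : Set V) ∈ G.edgeSet)
    (hcopy : ¬ G.ContainsCopy (Hypergraph.linearCycle r (2 * k)))
    (hhl : h < l) (hlk : l < k) (hlJ : l ≤ J)
    {x w : Finset V → V} {P : Finset (Finset V)} (hPE : P ⊆ E) (hx : ∀ e ∈ P, x e ∈ e)
    (hw : ∀ e ∈ P, w e ∈ e) (hne : ∀ e ∈ P, x e ≠ w e) (hwl : ∀ e ∈ P, T.lev (w e) = l)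
    (hmin : ∀ e ∈ P, ∀ z ∈ e, l ≤ T.lev z)
    {e₀ : V → Finset V} {w₀ : V → V}
    (he₀ : ∀ e ∈ P, e₀ (x e) ∈ E ∧ x e ∈ e₀ (x e) ∧ w₀ (x e) ∈ e₀ (x e) ∧ x e ≠ w₀ (x e) ∧
      T.lev (w₀ (x e)) = l ∧ ∀ z ∈ e₀ (x e), l ≤ T.lev z)
    (htop : ∀ e ∈ P, T.pe (T.par^[h + 1] (w e)) = T.pe (T.par^[h + 1] (w₀ (x e))))
    (hbranch : ∀ e ∈ P, T.pe (T.par^[h] (w e)) ≠ T.pe (T.par^[h] (w₀ (x e))))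
    {X W : Finset V} (hX : ∀ e ∈ P, x e ∈ X) (hW : ∀ e ∈ P, w e ∈ W) :
    #P ≤ 4 * (2 * k * r * r) * (#X + #W) := by
  by_contra! hlt
  -- `hbranch` separates `w e` only from the designated vertex of its own `x e`. After the cut, no
  -- branch of a `w e` is a designated branch of any other edge either.
  obtain ⟨c, hc⟩ := exists_directed_cut P (fun e => T.pe (T.par^[h] (w₀ (x e))))
    (fun e => T.pe (T.par^[h] (w e))) fun e he => (hbranch e he).symm
  set P₁ := {e ∈ P | c (T.pe (T.par^[h] (w₀ (x e)))) = true ∧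
    c (T.pe (T.par^[h] (w e))) = false} with hP₁
  have hlt₁ : 2 * k * r * r * (#X + #W) < #P₁ := by nlinarith
  -- The disjoint union keeps the two roles apart, as a vertex may occur both as an `x` and as a
  -- `w`.
  obtain ⟨P₂, hP₂, ⟨e₁, he₁⟩, hdeg⟩ := exists_subfamily_degree_gt
    (fun e => ({Sum.inl (x e), Sum.inr (w e)} : Finset (V ⊕ V))) (D := (2 * k * r * r : ℕ))
    (by positivity) (X.disjSum W) P₁ (by
      intro e he u hu
      have heP := (mem_filter.1 he).1
      simp only [mem_insert, mem_singleton] at hu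
      rcases hu with rfl | rfl
      · simpa using hX e heP
      · simpa using hW e heP) (by
      rw [card_disjSum]
      exact_mod_cast hlt₁)
  have hP₂P : P₂ ⊆ P := hP₂.trans (filter_subset _ _)
  -- By `htop`, edges sharing `x` or `w` have the same label at height `h + 1`, so this restriction
  -- loses no degree.
  set P₃ := {e ∈ P₂ | T.pe (T.par^[h + 1] (w e)) = T.pe (T.par^[h + 1] (w₀ (x e₁)))} with hP₃
  have hP₃P : P₃ ⊆ P := (filter_subset _ _).trans hP₂P
  have hdx : ∀ e ∈ P₃, 2 * k * r * r < #{f ∈ P₃ | x f = x e} := by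
    intro e he
    obtain ⟨he2, he3⟩ := mem_filter.1 he
    have h1 := hdeg e he2 (Sum.inl (x e)) (by simp)
    rw [Nat.cast_lt] at h1
    refine h1.trans_le (card_le_card fun f hf => ?_)
    simp only [mem_filter, mem_insert, mem_singleton, Sum.inl.injEq, reduceCtorEq, or_false] at hf
    refine mem_filter.2 ⟨mem_filter.2 ⟨hf.1, ?_⟩, hf.2.symm⟩
    rw [htop f (hP₂P hf.1), ← hf.2, ← htop e (hP₂P he2), he3]
  have hdw : ∀ e ∈ P₃, 2 * k * r * r < #{f ∈ P₃ | w f = w e} := by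
    intro e he
    obtain ⟨he2, he3⟩ := mem_filter.1 he
    have h1 := hdeg e he2 (Sum.inr (w e)) (by simp)
    rw [Nat.cast_lt] at h1
    refine h1.trans_le (card_le_card fun f hf => ?_)
    simp only [mem_filter, mem_insert, mem_singleton, Sum.inr.injEq, reduceCtorEq, false_or] at hf
    refine mem_filter.2 ⟨mem_filter.2 ⟨hf.1, ?_⟩, hf.2.symm⟩
    rw [← hf.2, he3]
  have he₁3 : e₁ ∈ P₃ := mem_filter.2 ⟨he₁, htop e₁ (hP₂P he₁)⟩
  obtain ⟨h1, h2, h3, h4, h5, h6⟩ := he₀ e₁ (hP₂P he₁)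
  refine hcopy (T.containsCopy_of_degree_gt hlin hcard hr hG hEG hhl hlk hlJ (hP₃P.trans hPE)
    (fun e he => hx e (hP₃P he)) (fun e he => hw e (hP₃P he)) (fun e he => hne e (hP₃P he))
    (fun e he => hwl e (hP₃P he)) (fun e he => hmin e (hP₃P he)) hdx hdw he₁3 h1 h2 h3 h4 h5 h6
    ?_ ?_)
  · intro e he
    exact T.iterate_eq_of_pe_eq (hwl e (hP₃P he)) h5 hlJ hhl (mem_filter.1 he).2
  · intro e he heq
    have hce := (mem_filter.1 (hP₂ (mem_filter.1 he).1)).2.2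
    have hce₁ := (mem_filter.1 (hP₂ he₁)).2.1
    rw [heq, hce₁] at hce
    exact absurd hce (by simp)

end LinearTree

/-! ### Counting edges with two vertices in a tree. -/

namespace LinearTree

variable {V : Type*} [DecidableEq V] {E : Finset (Finset V)} {J : ℕ} (T : LinearTree E J)

/-- The edges whose marked vertex `w e` of minimal level has level `l`. -/
theorem card_filter_lev_le [Fintype V]
    (hlin : ∀ e ∈ E, ∀ f ∈ E, e ≠ f → #(e ∩ f) ≤ 1) {r k : ℕ}
    (hcard : ∀ e ∈ E, #e = r) (hr : 2 ≤ r) {G : Hypergraph V} (hG : G.vertexSet = Set.univ)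
    (hEG : ∀ e ∈ E, (e : Set V) ∈ G.edgeSet)
    (hcopy : ¬ G.ContainsCopy (Hypergraph.linearCycle r (2 * k)))
    {x w : Finset V → V} {F : Finset (Finset V)} (hFE : F ⊆ E) (hx : ∀ e ∈ F, x e ∈ e)
    (hw : ∀ e ∈ F, w e ∈ e) (hne : ∀ e ∈ F, x e ≠ w e)
    (hmin : ∀ e ∈ F, ∀ z ∈ e, T.lev (w e) ≤ T.lev z)
    {X : Finset V} (hX : ∀ e ∈ F, x e ∈ X) (hW : ∀ e ∈ F, w e ∈ X) {l : ℕ} (hlk : l < k)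
    (hlJ : l ≤ J) :
    #{e ∈ F | T.lev (w e) = l} ≤
      2 * r * #X + 16 * (2 * k * r * r) * (#X + k * #{v ∈ X | T.lev v = l}) := by
  set N : V → Finset (Finset V) := fun y => {e ∈ F | T.lev (w e) = l ∧ x e = y} with hN
  have hNmem : ∀ {y e}, e ∈ N y ↔ e ∈ F ∧ T.lev (w e) = l ∧ x e = y := by simp [hN]
  have hinj : ∀ y, ∀ e ∈ N y, ∀ f ∈ N y, w e = w f → e = f := by
    intro y e he f hf hef
    rw [hNmem] at he hf
    by_contra hneq
    refine hne e he.1 (eq_of_mem_inter hlin (hFE he.1) (hFE hf.1) hneq (hx e he.1) ?_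
      (hw e he.1) (hef ▸ hw f hf.1))
    rw [he.2.2, ← hf.2.2]
    exact hx f hf.1
  -- At most `r` edges of `N y` share the label at height `0`, so the threshold `2 * r` supplies the
  -- hypothesis on the fibres of `g 0`. Below it the chosen values are irrelevant.
  have hsplit : ∀ y, ∃ e₀ : Finset V, ∃ h : ℕ, 2 * r < #(N y) → e₀ ∈ N y ∧ h < l ∧
      #(N y) ≤ 4 * #{e ∈ N y | T.pe (T.par^[h + 1] (w e)) = T.pe (T.par^[h + 1] (w e₀)) ∧
        T.pe (T.par^[h] (w e)) ≠ T.pe (T.par^[h] (w e₀))} := by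
    intro y
    by_cases hbig : 2 * r < #(N y)
    · obtain ⟨e₀, he₀, h, hh, hle⟩ := exists_split_level (N := N y)
        (card_pos.1 (by omega)) (fun i e => T.pe (T.par^[i] (w e))) l (by
          intro e he f hf
          rw [hNmem] at he hf
          have h1 := T.iterate_lev_eq_root (v := w e) (by omega)
          have h2 := T.iterate_lev_eq_root (v := w f) (by omega)
          rw [he.2.1] at h1
          rw [hf.2.1] at h2
          simp only [h1, h2]) (by
          intro b
          have hle : #{e ∈ N y | T.pe (T.par^[0] (w e)) = b} ≤ r := by
            rcases Nat.eq_zero_or_pos l with rfl | hl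
            · refine le_trans (card_le_card (filter_subset _ _)) (le_trans ?_ (by omega : 1 ≤ r))
              rw [card_le_one]
              intro e he f hf
              refine hinj y e he f hf ?_
              rw [hNmem] at he hf
              rw [T.eq_root _ he.2.1, T.eq_root _ hf.2.1]
            · rcases eq_empty_or_nonempty {e ∈ N y | T.pe (T.par^[0] (w e)) = b} with h0 | ⟨f, hf⟩
              · rw [h0]
                simp
              · have hbE : b ∈ E := by
                  rw [mem_filter, hNmem] at hf
                  rw [← hf.2]
                  exact T.pe_mem (w f) (by omega) (by omega)
                rw [← hcard b hbE]
                refine card_le_card_of_injOn w ?_ ?_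
                · intro e he
                  simp only [coe_filter, Set.mem_ofPred_eq, hNmem] at he
                  rw [← he.2]
                  exact T.mem_pe (w e) (by omega) (by omega)
                · intro e he f hf hef
                  simp only [coe_filter, Set.mem_ofPred_eq] at he hf
                  exact hinj y e he.1 f hf.1 hef
          omega)
      exact ⟨e₀, h, fun _ => ⟨he₀, hh, hle⟩⟩
    · exact ⟨∅, 0, fun h => absurd h hbig⟩
  choose e₀ hh hspec using hsplit
  set P : ℕ → Finset (Finset V) := fun h => {e ∈ F | T.lev (w e) = l ∧ 2 * r < #(N (x e)) ∧
    hh (x e) = h ∧ T.pe (T.par^[h + 1] (w e)) = T.pe (T.par^[h + 1] (w (e₀ (x e)))) ∧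
    T.pe (T.par^[h] (w e)) ≠ T.pe (T.par^[h] (w (e₀ (x e))))} with hP
  have hNle : ∀ y, #(N y) ≤ 2 * r + 4 * ∑ h ∈ range l, #{e ∈ P h | x e = y} := by
    intro y
    by_cases hbig : 2 * r < #(N y)
    · obtain ⟨-, h2, h3⟩ := hspec y hbig
      refine h3.trans (le_add_left (Nat.mul_le_mul_left _ ?_))
      refine le_trans (card_le_card ?_)
        (single_le_sum (f := fun h => #{e ∈ P h | x e = y}) (fun _ _ => Nat.zero_le _)
          (mem_range.2 h2))
      intro e he
      rw [mem_filter, hNmem] at he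
      obtain ⟨⟨ha, hb, rfl⟩, hc, hd⟩ := he
      exact mem_filter.2 ⟨mem_filter.2 ⟨ha, hb, hbig, rfl, hc, hd⟩, rfl⟩
    · omega
  have hPle : ∀ h ∈ range l, #(P h) ≤ 4 * (2 * k * r * r) *
      (#{y ∈ X | hh y = h} + #{v ∈ X | T.lev v = l}) := by
    intro h hhl
    have hPF : ∀ e ∈ P h, e ∈ F ∧ T.lev (w e) = l ∧ 2 * r < #(N (x e)) ∧
      hh (x e) = h ∧ T.pe (T.par^[h + 1] (w e)) = T.pe (T.par^[h + 1] (w (e₀ (x e)))) ∧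
      T.pe (T.par^[h] (w e)) ≠ T.pe (T.par^[h] (w (e₀ (x e)))) := fun e he => mem_filter.1 he
    refine T.card_le_of_not_containsCopy hlin hcard hr hG hEG hcopy (mem_range.1 hhl) hlk hlJ
      ((filter_subset _ _).trans hFE) (x := x) (w := w) (fun e he => hx e (hPF e he).1)
      (fun e he => hw e (hPF e he).1) (fun e he => hne e (hPF e he).1)
      (fun e he => (hPF e he).2.1) ?_ (e₀ := e₀) (w₀ := fun y => w (e₀ y)) ?_
      (fun e he => (hPF e he).2.2.2.2.1) (fun e he => (hPF e he).2.2.2.2.2) ?_ ?_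
    · intro e he z hz
      rw [← (hPF e he).2.1]
      exact hmin e (hPF e he).1 z hz
    · intro e he
      obtain ⟨h1, h2, h3⟩ := hNmem.1 (hspec (x e) (hPF e he).2.2.1).1
      refine ⟨hFE h1, ?_, hw _ h1, ?_, h2, fun z hz => h2 ▸ hmin _ h1 z hz⟩
      · have := hx _ h1
        rwa [h3] at this
      · have := hne _ h1
        rwa [h3] at this
    · exact fun e he => mem_filter.2 ⟨hX e (hPF e he).1, (hPF e he).2.2.2.1⟩
    · exact fun e he => mem_filter.2 ⟨hW e (hPF e he).1, (hPF e he).2.1⟩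
  have hFsum : #{e ∈ F | T.lev (w e) = l} = ∑ y ∈ X, #(N y) := by
    rw [card_eq_sum_card_fiberwise (f := x) (t := X)]
    · simp only [filter_filter, hN]
    · intro e he
      exact hX e (mem_filter.1 he).1
  have hPsum : ∀ h, ∑ y ∈ X, #{e ∈ P h | x e = y} = #(P h) := by
    intro h
    refine (card_eq_sum_card_fiberwise (f := x) (t := X) ?_).symm
    intro e he
    exact hX e (mem_filter.1 he).1
  -- Each `y` has a single height `hh y`, so summing over heights costs no extra factor on this
  -- term.
  have hXsum : ∑ h ∈ range l, #{y ∈ X | hh y = h} ≤ #X := by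
    rw [← card_biUnion]
    · exact card_le_card (biUnion_subset.2 fun _ _ => filter_subset _ _)
    · intro a _ b _ hab
      exact disjoint_filter.2 fun y _ h1 h2 => hab (h1.symm.trans h2)
  calc #{e ∈ F | T.lev (w e) = l}
      ≤ ∑ y ∈ X, (2 * r + 4 * ∑ h ∈ range l, #{e ∈ P h | x e = y}) :=
        hFsum ▸ sum_le_sum fun y _ => hNle y
    _ = 2 * r * #X + 4 * ∑ h ∈ range l, #(P h) := by
        rw [sum_add_distrib, sum_const, ← mul_sum, sum_comm, smul_eq_mul, mul_comm]
        simp only [hPsum]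
    _ ≤ 2 * r * #X + 4 * ∑ h ∈ range l, 4 * (2 * k * r * r) *
          (#{y ∈ X | hh y = h} + #{v ∈ X | T.lev v = l}) := by
        gcongr with h hhl
        exact hPle h hhl
    _ = 2 * r * #X + 16 * (2 * k * r * r) *
          (∑ h ∈ range l, #{y ∈ X | hh y = h} + l * #{v ∈ X | T.lev v = l}) := by
        rw [← mul_sum, sum_add_distrib, sum_const, card_range, smul_eq_mul]
        ring
    _ ≤ _ := by gcongr

/-- In the absence of linear cycles of length `2 * k`, there are few edges with two vertices in a
linear tree, one of which has level less than `k`. -/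
theorem card_edges_le [Fintype V]
    (hlin : ∀ e ∈ E, ∀ f ∈ E, e ≠ f → #(e ∩ f) ≤ 1) {r k : ℕ}
    (hcard : ∀ e ∈ E, #e = r) (hr : 2 ≤ r) {G : Hypergraph V} (hG : G.vertexSet = Set.univ)
    (hEG : ∀ e ∈ E, (e : Set V) ∈ G.edgeSet)
    (hcopy : ¬ G.ContainsCopy (Hypergraph.linearCycle r (2 * k)))
    {F : Finset (Finset V)} (hFE : F ⊆ E)
    (hF : ∀ e ∈ F, ∃ u ∈ e, ∃ v ∈ e, u ≠ v ∧ T.lev u < k ∧ T.lev u ≤ J ∧ T.lev v ≤ J) :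
    #F ≤ 66 * k ^ 2 * r ^ 2 * #{v | T.lev v ≤ J} := by
  have hmark : ∀ e : Finset V, ∃ x w : V, e ∈ F → x ∈ e ∧ w ∈ e ∧ x ≠ w ∧ T.lev x ≤ J ∧
      T.lev w < k ∧ T.lev w ≤ J ∧ ∀ z ∈ e, T.lev w ≤ T.lev z := by
    intro e
    by_cases he : e ∈ F
    · obtain ⟨u, hu, v, hv, huv, h1, h2, h3⟩ := hF e he
      obtain ⟨w, hw, hmin⟩ := exists_min_image e T.lev ⟨u, hu⟩
      have := hmin u hu
      by_cases hwv : v = w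
      · exact ⟨u, w, fun _ => ⟨hu, hw, hwv ▸ huv, h2, by omega, by omega, hmin⟩⟩
      · exact ⟨v, w, fun _ => ⟨hv, hw, hwv, h3, by omega, by omega, hmin⟩⟩
    · obtain ⟨v⟩ : Nonempty V := ⟨T.root⟩
      exact ⟨v, v, fun h => absurd h he⟩
  choose x w hxw using hmark
  set X : Finset V := {v | T.lev v ≤ J} with hX
  have hlevel : ∀ l ∈ range k, #{e ∈ F | T.lev (w e) = l} ≤
      2 * r * #X + 16 * (2 * k * r * r) * (#X + k * #{v ∈ X | T.lev v = l}) := by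
    intro l hl
    by_cases hlJ : l ≤ J
    · refine T.card_filter_lev_le hlin hcard hr hG hEG hcopy hFE (fun e he => (hxw e he).1)
        (fun e he => (hxw e he).2.1) (fun e he => (hxw e he).2.2.1)
        (fun e he => (hxw e he).2.2.2.2.2.2) ?_ ?_ (mem_range.1 hl) hlJ
      · exact fun e he => mem_filter.2 ⟨mem_univ _, (hxw e he).2.2.2.1⟩
      · exact fun e he => mem_filter.2 ⟨mem_univ _, (hxw e he).2.2.2.2.2.1⟩
    · rw [filter_false_of_mem]
      · simp
      · intro e he h
        have := (hxw e he).2.2.2.2.2.1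
        omega
  have hsum : ∑ l ∈ range k, #{v ∈ X | T.lev v = l} ≤ #X := by
    rw [← card_biUnion]
    · exact card_le_card (biUnion_subset.2 fun _ _ => filter_subset _ _)
    · intro a _ b _ hab
      exact disjoint_filter.2 fun y _ h1 h2 => hab (h1.symm.trans h2)
  calc #F = ∑ l ∈ range k, #{e ∈ F | T.lev (w e) = l} :=
        card_eq_sum_card_fiberwise fun e he => mem_coe.2 (mem_range.2 (hxw e he).2.2.2.2.1)
    _ ≤ ∑ l ∈ range k,
          (2 * r * #X + 16 * (2 * k * r * r) * (#X + k * #{v ∈ X | T.lev v = l})) :=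
        sum_le_sum hlevel
    _ = k * (2 * r * #X) + 16 * (2 * k * r * r) *
          (k * #X + k * ∑ l ∈ range k, #{v ∈ X | T.lev v = l}) := by
        rw [sum_add_distrib, sum_const, card_range, ← mul_sum, sum_add_distrib, sum_const,
          card_range, ← mul_sum, smul_eq_mul, smul_eq_mul]
    _ ≤ k * (2 * r * #X) + 16 * (2 * k * r * r) * (k * #X + k * #X) := by gcongr
    -- The factor `16` is `4` from the split level times `4` from the cut; with `2 * k * r * r` and
    -- two terms `k * #X` it gives `64`.
    _ = (2 * (k * r)) * #X + 64 * (k * r) ^ 2 * #X := by ring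
    _ ≤ (2 * (k * r) ^ 2) * #X + 64 * (k * r) ^ 2 * #X := by
        gcongr
        exact Nat.le_self_pow (by norm_num) _
    _ = 66 * k ^ 2 * r ^ 2 * #X := by ring

end LinearTree

/-! ### Growing linear trees. -/

namespace LinearTree

variable {V : Type*} [DecidableEq V] {E : Finset (Finset V)}

/-- The linear tree of height zero. -/
def trivial (E : Finset (Finset V)) (v : V) : LinearTree E 0 where
  -- Level `1` exceeds the height `0` and so means outside the tree.
  lev u := if u = v then 0 else 1
  pe _ := ∅
  par _ := v
  spine := {v}
  root := v
  lev_root := by simp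
  root_mem_spine := by simp
  eq_root u hu := by
    by_contra h
    simp [h] at hu
  pe_mem := by intros; omega
  mem_pe := by intros; omega
  par_mem_pe := by intros; omega
  lev_par := by intros; omega
  par_mem_spine := by intros; omega
  sibling := by intros; omega
  exists_spine := by intros; omega
  spine_inj := by intros; omega

variable {J : ℕ} (T : LinearTree E J)

theorem lev_le_of_mem_pe {v : V} (hv : 1 ≤ T.lev v) (hv' : T.lev v ≤ J) {z : V} (hz : z ∈ T.pe v) :
    T.lev z ≤ T.lev v := by
  by_cases h : z = T.par v
  · have := T.lev_par v hv hv'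
    rw [h]
    omega
  · exact (T.sibling v hv hv' z hz h).2.2.le

/-- The number of vertices of a level is at most `r` times the number of spine vertices. -/
theorem card_lev_le [Fintype V] {r : ℕ} (hcard : ∀ e ∈ E, #e = r) {j : ℕ} (hr : 1 ≤ r)
    (hjJ : j ≤ J) : #{v | T.lev v = j} ≤ r * #{v ∈ T.spine | T.lev v = j} := by
  rcases Nat.eq_zero_or_pos j with rfl | hj
  · have h1 : #{v | T.lev v = 0} ≤ 1 := by
      rw [card_le_one]
      intro u hu v hv
      rw [T.eq_root u (mem_filter.1 hu).2, T.eq_root v (mem_filter.1 hv).2]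
    have h2 : 0 < #{v ∈ T.spine | T.lev v = 0} :=
      card_pos.2 ⟨T.root, mem_filter.2 ⟨T.root_mem_spine, T.lev_root⟩⟩
    nlinarith
  · have hsub : ({v | T.lev v = j} : Finset V) ⊆ ({v ∈ T.spine | T.lev v = j}).biUnion T.pe := by
      intro v hv
      have hvj := (mem_filter.1 hv).2
      obtain ⟨u, hu, h1, h2⟩ := T.exists_spine v (by omega) (by omega)
      exact mem_biUnion.2 ⟨u, mem_filter.2 ⟨hu, by omega⟩, h1 ▸ T.mem_pe v (by omega) (by omega)⟩
    refine (card_le_card hsub).trans ?_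
    rw [mul_comm]
    refine card_biUnion_le_card_mul _ _ r fun u hu => ?_
    have := (mem_filter.1 hu).2
    exact (hcard _ (T.pe_mem u (by omega) (by omega))).le

/-- A linear tree can be extended by one level in such a way that all edges through a spine vertex
of the last level have a further vertex in the new tree. -/
theorem exists_extension (hcard : ∀ e ∈ E, 2 ≤ #e) :
    ∃ T' : LinearTree E (J + 1), (∀ v, T'.lev v ≤ J ↔ T.lev v ≤ J) ∧
      (∀ v, T.lev v ≤ J → T'.lev v = T.lev v) ∧
      ∀ e ∈ E, ∀ s ∈ e, s ∈ T.spine → T.lev s = J → ∃ v ∈ e, v ≠ s ∧ T'.lev v ≤ J + 1 := by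
  classical
  -- The candidates meet the tree only in a spine vertex of the last level. `M` is a largest set of
  -- candidates that are pairwise disjoint outside the tree.
  set C : Finset (Finset V) := {e ∈ E | ∃ s ∈ e, s ∈ T.spine ∧ T.lev s = J ∧
    ∀ z ∈ e, z ≠ s → J < T.lev z} with hC
  obtain ⟨M, hM, hmax⟩ := exists_max_image
    {M ∈ C.powerset | ∀ e ∈ M, ∀ f ∈ M, ∀ z ∈ e, z ∈ f → J < T.lev z → e = f} card
    ⟨∅, by simp⟩
  rw [mem_filter, mem_powerset] at hM
  obtain ⟨hMC, hMdis⟩ := hM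
  have hbase : ∀ e : Finset V, ∃ s c : V, e ∈ M → e ∈ E ∧ s ∈ e ∧ s ∈ T.spine ∧ T.lev s = J ∧
      (∀ z ∈ e, z ≠ s → J < T.lev z) ∧ c ∈ e ∧ J < T.lev c := by
    intro e
    by_cases he : e ∈ M
    · obtain ⟨heE, s, hs, h1, h2, h3⟩ := mem_filter.1 (hMC he)
      obtain ⟨c, hc, hcs⟩ := exists_mem_ne (hcard e heE) s
      exact ⟨s, c, fun _ => ⟨heE, hs, h1, h2, h3, hc, h3 c hc hcs⟩⟩
    · exact ⟨T.root, T.root, fun h => absurd h he⟩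
  choose sp ch hsp using hbase
  have hnew : ∀ v : V, ∃ e : Finset V, (∃ f ∈ M, v ∈ f) → e ∈ M ∧ v ∈ e := by
    intro v
    by_cases h : ∃ f ∈ M, v ∈ f
    · obtain ⟨f, hf⟩ := h
      exact ⟨f, fun _ => hf⟩
    · exact ⟨∅, fun h' => absurd h' h⟩
  choose ed hed using hnew
  have hed_eq : ∀ e ∈ M, ∀ v ∈ e, J < T.lev v → ed v = e := by
    intro e he v hv hJ
    obtain ⟨h1, h2⟩ := hed v ⟨e, he, hv⟩
    exact hMdis _ h1 _ he v h2 hv hJ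
  -- Level `J + 2` marks the vertices outside the new tree.
  set lev' : V → ℕ := fun v => if T.lev v ≤ J then T.lev v else
    if ∃ f ∈ M, v ∈ f then J + 1 else J + 2 with hlev'
  have hold : ∀ v, T.lev v ≤ J → lev' v = T.lev v := fun v hv => if_pos hv
  have hnewl : ∀ e ∈ M, ∀ v ∈ e, J < T.lev v → lev' v = J + 1 := by
    intro e he v hv hJ
    simp only [hlev', if_neg (not_le.2 hJ)]
    rw [if_pos ⟨e, he, hv⟩]
  have hcase : ∀ v, lev' v ≤ J + 1 → (T.lev v ≤ J ∧ lev' v = T.lev v) ∨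
      (J < T.lev v ∧ lev' v = J + 1 ∧ ed v ∈ M ∧ v ∈ ed v) := by
    intro v hv
    by_cases h1 : T.lev v ≤ J
    · exact Or.inl ⟨h1, hold v h1⟩
    · by_cases h2 : ∃ f ∈ M, v ∈ f
      · obtain ⟨h3, h4⟩ := hed v h2
        exact Or.inr ⟨not_le.1 h1, hnewl _ h3 v h4 (not_le.1 h1), h3, h4⟩
      · simp only [hlev', if_neg h1, if_neg h2] at hv
        omega
  set pe' : V → Finset V := fun v => if T.lev v ≤ J then T.pe v else ed v with hpe'
  set par' : V → V := fun v => if T.lev v ≤ J then T.par v else sp (ed v) with hpar'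
  have hpe_old : ∀ v, T.lev v ≤ J → pe' v = T.pe v := fun v hv => if_pos hv
  have hpe_new : ∀ v, J < T.lev v → pe' v = ed v := fun v hv => if_neg (not_le.2 hv)
  have hpar_old : ∀ v, T.lev v ≤ J → par' v = T.par v := fun v hv => if_pos hv
  have hpar_new : ∀ v, J < T.lev v → par' v = sp (ed v) := fun v hv => if_neg (not_le.2 hv)
  set spine' : Finset V := {v ∈ T.spine | T.lev v ≤ J} ∪ M.image ch with hspine'
  have hspine_old : ∀ v ∈ T.spine, T.lev v ≤ J → v ∈ spine' := fun v hv hJ =>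
    mem_union_left _ (mem_filter.2 ⟨hv, hJ⟩)
  let T' : LinearTree E (J + 1) :=
    { lev := lev'
      pe := pe'
      par := par'
      spine := spine'
      root := T.root
      lev_root := by
        rw [hold _ (by rw [T.lev_root]; omega), T.lev_root]
      root_mem_spine := hspine_old _ T.root_mem_spine (by rw [T.lev_root]; omega)
      eq_root := by
        intro v hv
        rcases hcase v (by omega) with h | h
        · exact T.eq_root v (by omega)
        · omega
      pe_mem := by
        intro v hv hv'
        rcases hcase v hv' with ⟨h1, h2⟩ | ⟨h1, h2, h3, h4⟩
        · rw [hpe_old v h1]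
          exact T.pe_mem v (by omega) h1
        · rw [hpe_new v h1]
          exact (hsp _ h3).1
      mem_pe := by
        intro v hv hv'
        rcases hcase v hv' with ⟨h1, h2⟩ | ⟨h1, h2, h3, h4⟩
        · rw [hpe_old v h1]
          exact T.mem_pe v (by omega) h1
        · rw [hpe_new v h1]
          exact h4
      par_mem_pe := by
        intro v hv hv'
        rcases hcase v hv' with ⟨h1, h2⟩ | ⟨h1, h2, h3, h4⟩
        · rw [hpe_old v h1, hpar_old v h1]
          exact T.par_mem_pe v (by omega) h1
        · rw [hpe_new v h1, hpar_new v h1]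
          exact (hsp _ h3).2.1
      lev_par := by
        intro v hv hv'
        rcases hcase v hv' with ⟨h1, h2⟩ | ⟨h1, h2, h3, h4⟩
        · have := T.lev_par v (by omega) h1
          rw [hpar_old v h1, hold _ (by omega)]
          omega
        · have := (hsp _ h3).2.2.2.1
          rw [hpar_new v h1, hold _ (by omega)]
          omega
      par_mem_spine := by
        intro v hv hv'
        rcases hcase v hv' with ⟨h1, h2⟩ | ⟨h1, h2, h3, h4⟩
        · have := T.lev_par v (by omega) h1
          rw [hpar_old v h1]
          exact hspine_old _ (T.par_mem_spine v (by omega) h1) (by omega)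
        · obtain ⟨-, -, h5, h6, -⟩ := hsp _ h3
          rw [hpar_new v h1]
          exact hspine_old _ h5 (by omega)
      sibling := by
        intro v hv hv' z hz hzp
        rcases hcase v hv' with ⟨h1, h2⟩ | ⟨h1, h2, h3, h4⟩
        · rw [hpe_old v h1] at hz ⊢
          rw [hpar_old v h1] at hzp ⊢
          obtain ⟨h5, h6, h7⟩ := T.sibling v (by omega) h1 z hz hzp
          rw [hpe_old z (by omega), hpar_old z (by omega), hold z (by omega)]
          exact ⟨h5, h6, by omega⟩
        · rw [hpe_new v h1] at hz ⊢
          rw [hpar_new v h1] at hzp ⊢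
          have h5 := (hsp _ h3).2.2.2.2.1 z hz hzp
          have h6 := hed_eq _ h3 z hz h5
          rw [hpe_new z h5, hpar_new z h5, h6, hnewl _ h3 z hz h5]
          exact ⟨rfl, rfl, h2.symm⟩
      exists_spine := by
        intro v hv hv'
        rcases hcase v hv' with ⟨h1, h2⟩ | ⟨h1, h2, h3, h4⟩
        · obtain ⟨u, hu, h3, h4⟩ := T.exists_spine v (by omega) h1
          refine ⟨u, hspine_old u hu (by omega), ?_, ?_⟩
          · rw [hpe_old u (by omega), hpe_old v h1, h3]
          · rw [hold u (by omega), h2, h4]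
        · obtain ⟨-, -, -, -, -, h5, h6⟩ := hsp _ h3
          refine ⟨ch (ed v), mem_union_right _ (mem_image_of_mem _ h3), ?_, ?_⟩
          · rw [hpe_new _ h6, hpe_new v h1, hed_eq _ h3 _ h5 h6]
          · rw [hnewl _ h3 _ h5 h6, h2]
      spine_inj := by
        have hmixed : ∀ u v, 1 ≤ lev' u → lev' u ≤ J + 1 → lev' v ≤ J + 1 → T.lev u ≤ J →
            J < T.lev v → pe' u ≠ pe' v := by
          intro u v hu hu' hv' h1 h2 heq
          rcases hcase v hv' with h3 | ⟨-, -, -, h4⟩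
          · omega
          · rw [hpe_old u h1, hpe_new v h2] at heq
            rw [hold u h1] at hu
            have := T.lev_le_of_mem_pe hu h1 (heq ▸ h4)
            omega
        intro u hu v hv hu1 hu2 hv1 hv2 heq
        rcases le_or_gt (T.lev u) J with h1 | h1 <;> rcases le_or_gt (T.lev v) J with h2 | h2
        · have hs : ∀ y ∈ spine', T.lev y ≤ J → y ∈ T.spine := by
            intro y hy hyJ
            rcases mem_union.1 hy with hy | hy
            · exact (mem_filter.1 hy).1
            · obtain ⟨e, he, rfl⟩ := mem_image.1 hy
              have := (hsp _ he).2.2.2.2.2.2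
              omega
          rw [hpe_old u h1, hpe_old v h2] at heq
          rw [hold u h1] at hu1
          rw [hold v h2] at hv1
          exact T.spine_inj u (hs u hu h1) v (hs v hv h2) hu1 h1 hv1 h2 heq
        · exact absurd heq (hmixed u v hu1 hu2 hv2 h1 h2)
        · exact absurd heq.symm (hmixed v u hv1 hv2 hu2 h2 h1)
        · have hs : ∀ y ∈ spine', J < T.lev y → y = ch (ed y) := by
            intro y hy hyJ
            rcases mem_union.1 hy with hy | hy
            · have := (mem_filter.1 hy).2
              omega
            · obtain ⟨e, he, rfl⟩ := mem_image.1 hy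
              rw [hed_eq e he _ (hsp _ he).2.2.2.2.2.1 hyJ]
          rw [hpe_new u h1, hpe_new v h2] at heq
          rw [hs u hu h1, hs v hv h2, heq] }
  refine ⟨T', ?_, hold, ?_⟩
  · intro v
    constructor
    · intro h
      have h' : lev' v ≤ J := h
      rcases hcase v (by omega) with h1 | h1
      · exact h1.1
      · omega
    · intro h
      exact (hold v h).le.trans h
  · intro e he s hs hsp' hsJ
    -- An edge meeting the new tree only in `s` would be a candidate that could be added to `M`.
    by_contra! hcon
    have hcon' : ∀ z ∈ e, z ≠ s → J + 1 < lev' z := hcon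
    have hfar : ∀ z ∈ e, z ≠ s → J < T.lev z := by
      intro z hz hzs
      by_contra! hle
      have := hcon' z hz hzs
      rw [hold z hle] at this
      omega
    have hfree : ∀ z ∈ e, J < T.lev z → ∀ f ∈ M, z ∉ f := by
      intro z hz hzJ f hf hzf
      have h1 := hcon' z hz (by rintro rfl; omega)
      rw [hnewl f hf z hzf hzJ] at h1
      omega
    have heM : e ∉ M := by
      intro heM
      obtain ⟨c, hc, hcs⟩ := exists_mem_ne (hcard e he) s
      exact hfree c hc (hfar c hc hcs) e heM hc
    have := hmax (insert e M) (by
      rw [mem_filter, mem_powerset, insert_subset_iff]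
      refine ⟨⟨mem_filter.2 ⟨he, s, hs, hsp', hsJ, hfar⟩, hMC⟩, ?_⟩
      intro f hf g hg z hzf hzg hzJ
      rcases mem_insert.1 hf with hf | hf <;> rcases mem_insert.1 hg with hg | hg
      · rw [hf, hg]
      · exact absurd hzg (hfree z (hf ▸ hzf) hzJ g hg)
      · exact absurd hzf (hfree z (hg ▸ hzg) hzJ f hf)
      · exact hMdis f hf g hg z hzf hzg hzJ)
    rw [card_insert_of_notMem heM] at this
    omega

end LinearTree

namespace LinearTree

/-- In a linear `r`-graph of large minimum degree without linear cycles of length `2 * k`, there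
are linear trees of each height `J ≤ k` that grow exponentially. -/
theorem exists_large {V : Type*} [Fintype V] [DecidableEq V] {E : Finset (Finset V)}
    (hlin : ∀ e ∈ E, ∀ f ∈ E, e ≠ f → #(e ∩ f) ≤ 1) {r k : ℕ}
    (hcard : ∀ e ∈ E, #e = r) (hr : 2 ≤ r) (hk : 1 ≤ k) {G : Hypergraph V}
    (hG : G.vertexSet = Set.univ) (hEG : ∀ e ∈ E, (e : Set V) ∈ G.edgeSet)
    (hcopy : ¬ G.ContainsCopy (Hypergraph.linearCycle r (2 * k)))
    {d a : ℝ} (ha : 2 ≤ a) (had : 132 * k ^ 2 * r ^ 4 * a ≤ d)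
    (hdeg : ∀ e ∈ E, ∀ v ∈ e, d ≤ #{f ∈ E | v ∈ f}) (hE : E.Nonempty) (J : ℕ) (hJ : J ≤ k) :
    ∃ T : LinearTree E J, a ^ J ≤ #{v | T.lev v ≤ J} ∧
      #{v | T.lev v ≤ J} ≤ 2 * #{v | T.lev v = J} ∧
      ∀ s ∈ T.spine, T.lev s = J → ∃ e ∈ E, s ∈ e := by
  induction J with
  | zero =>
    obtain ⟨e, he⟩ := hE
    obtain ⟨v, hv⟩ : e.Nonempty := card_pos.1 (by rw [hcard e he]; omega)
    have hpos : 0 < #{u | (trivial E v).lev u = 0} :=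
      card_pos.2 ⟨v, mem_filter.2 ⟨mem_univ _, (trivial E v).lev_root⟩⟩
    refine ⟨trivial E v, ?_, ?_, ?_⟩
    · simp only [Nat.le_zero, pow_zero]
      exact_mod_cast hpos
    · simp only [Nat.le_zero]
      omega
    · intro s hs _
      have : s = v := mem_singleton.1 hs
      exact ⟨e, he, this ▸ hv⟩
  | succ J ih =>
    obtain ⟨T, hlarge, hlast, hspine⟩ := ih (by omega)
    obtain ⟨T', hT1, hT2, hT3⟩ := T.exists_extension fun e he => by rw [hcard e he]; omega
    set S := {s ∈ T.spine | T.lev s = J} with hS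
    set F := {e ∈ E | ∃ s ∈ S, s ∈ e} with hF
    have hFle : #F ≤ 66 * k ^ 2 * r ^ 2 * #{v | T'.lev v ≤ J + 1} := by
      refine T'.card_edges_le hlin hcard hr hG hEG hcopy (filter_subset _ _) ?_
      intro e he
      obtain ⟨heE, s, hs, hse⟩ := mem_filter.1 he
      obtain ⟨hs1, hs2⟩ := mem_filter.1 hs
      obtain ⟨v, hv, hvs, hvl⟩ := hT3 e heE s hse hs1 hs2
      have := hT2 s hs2.le
      exact ⟨s, hse, v, hv, hvs.symm, by omega, by omega, hvl⟩
    -- Double counting: an edge of `F` contains at most `r` vertices of `S`.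
    have hcount : ∑ s ∈ S, #{f ∈ E | s ∈ f} ≤ #F * r := by
      have h1 : ∀ s ∈ S, #{f ∈ E | s ∈ f} = #{f ∈ F | s ∈ f} := by
        intro s hs
        rw [hF, filter_filter]
        congr 1
        refine filter_congr fun f _ => ⟨fun h => ⟨⟨s, hs, h⟩, h⟩, fun h => h.2⟩
      rw [sum_congr rfl h1]
      simp only [card_filter]
      rw [sum_comm]
      simp only [← card_filter]
      refine sum_le_card_nsmul _ _ r fun f hf => ?_
      rw [← hcard f (mem_filter.1 hf).1]
      exact card_le_card fun s hs => (mem_filter.1 hs).2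
    have hlow : d * #S ≤ ∑ s ∈ S, (#{f ∈ E | s ∈ f} : ℝ) := by
      rw [mul_comm, ← nsmul_eq_mul]
      refine card_nsmul_le_sum _ _ _ fun s hs => ?_
      obtain ⟨hs1, hs2⟩ := mem_filter.1 hs
      obtain ⟨e, he, hse⟩ := hspine s hs1 hs2
      exact hdeg e he s hse
    have hlevS := T.card_lev_le hcard (j := J) (by omega) le_rfl
    have hu : #{v | T'.lev v ≤ J} = #{v | T.lev v ≤ J} := by
      simp only [hT1]
    have hsplit : #{v | T'.lev v ≤ J + 1} = #{v | T'.lev v ≤ J} + #{v | T'.lev v = J + 1} := by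
      rw [← card_union_of_disjoint]
      · congr 1
        ext v
        simp only [mem_filter, mem_univ, true_and, mem_union]
        omega
      · exact disjoint_filter.2 fun v _ h1 h2 => by omega
    -- At least half of the old tree lies in its last level, which has at most `r * #S` vertices.
    -- This contributes `2 * r`, and the upper bound for `d * #S` contributes `66 * k ^ 2 * r ^ 3`.
    have hgrow : a * #{v | T.lev v ≤ J} ≤ #{v | T'.lev v ≤ J + 1} := by
      have hc : (0 : ℝ) < 66 * k ^ 2 * r ^ 3 := by positivity
      have h1 : (#{v | T.lev v ≤ J} : ℝ) ≤ 2 * (r * #S) := by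
        exact_mod_cast hlast.trans (Nat.mul_le_mul_left 2 hlevS)
      have h2 : d * #S ≤ 66 * k ^ 2 * r ^ 3 * #{v | T'.lev v ≤ J + 1} := by
        refine hlow.trans ?_
        have h3 : ∑ s ∈ S, #{f ∈ E | s ∈ f} ≤
            66 * k ^ 2 * r ^ 2 * #{v | T'.lev v ≤ J + 1} * r :=
          hcount.trans (Nat.mul_le_mul_right r hFle)
        calc ∑ s ∈ S, (#{f ∈ E | s ∈ f} : ℝ)
            ≤ 66 * k ^ 2 * r ^ 2 * #{v | T'.lev v ≤ J + 1} * r := by exact_mod_cast h3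
          _ = _ := by ring
      have h4 : 132 * k ^ 2 * r ^ 4 * a * #S ≤ d * #S :=
        mul_le_mul_of_nonneg_right had (by positivity)
      refine le_of_mul_le_mul_left ?_ hc
      calc 66 * (k : ℝ) ^ 2 * r ^ 3 * (a * #{v | T.lev v ≤ J})
          ≤ 66 * (k : ℝ) ^ 2 * r ^ 3 * (a * (2 * (r * #S))) := by gcongr
        _ = 132 * k ^ 2 * r ^ 4 * a * #S := by ring
        _ ≤ _ := h4.trans h2
    refine ⟨T', ?_, ?_, ?_⟩
    · rw [pow_succ']
      exact (mul_le_mul_of_nonneg_left hlarge (by linarith)).trans hgrow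
    -- Since `a ≥ 2`, the tree has at least doubled, so the new level contains at least half of it.
    · have h1 : (2 : ℝ) * #{v | T.lev v ≤ J} ≤ #{v | T'.lev v ≤ J + 1} :=
        (mul_le_mul_of_nonneg_right ha (by positivity)).trans hgrow
      have h2 : 2 * #{v | T.lev v ≤ J} ≤ #{v | T'.lev v ≤ J + 1} := by exact_mod_cast h1
      omega
    · intro s _ hs
      exact ⟨_, T'.pe_mem s (by omega) (by omega), T'.mem_pe s (by omega) (by omega)⟩

end LinearTree

/-! ### The bound on the number of edges. -/

/-- A linear `r`-graph on `n` vertices without linear cycles of length `2 * k` has at most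
`264 * k ^ 2 * r ^ 4 * n ^ (1 + 1 / k)` edges. -/
theorem Hypergraph.card_edges_le_of_not_containsCopy {V : Type*} [Fintype V] [DecidableEq V]
    {E : Finset (Finset V)} (hlin : ∀ e ∈ E, ∀ f ∈ E, e ≠ f → #(e ∩ f) ≤ 1) {r k : ℕ}
    (hcard : ∀ e ∈ E, #e = r) (hr : 2 ≤ r) (hk : 1 ≤ k) {G : Hypergraph V}
    (hG : G.vertexSet = Set.univ) (hEG : ∀ e ∈ E, (e : Set V) ∈ G.edgeSet)
    (hcopy : ¬ G.ContainsCopy (Hypergraph.linearCycle r (2 * k))) :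
    (#E : ℝ) ≤ 264 * k ^ 2 * r ^ 4 * (Fintype.card V : ℝ) ^ (1 + 1 / (k : ℝ)) := by
  by_contra! hlt
  set n := Fintype.card V with hn
  have hEne : E.Nonempty := by
    rw [← card_pos]
    exact_mod_cast (lt_of_le_of_lt (by positivity) hlt : (0 : ℝ) < #E)
  have hn1 : (1 : ℝ) ≤ n := by
    obtain ⟨e, he⟩ := hEne
    obtain ⟨v, -⟩ : e.Nonempty := card_pos.1 (by rw [hcard e he]; omega)
    have : Nonempty V := ⟨v⟩
    exact_mod_cast (Fintype.card_pos : 0 < Fintype.card V)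
  set b : ℝ := (n : ℝ) ^ (1 / (k : ℝ)) with hb
  have hb1 : 1 ≤ b := Real.one_le_rpow hn1 (by positivity)
  have hbk : b ^ k = n := by
    rw [hb, one_div, Real.rpow_inv_natCast_pow (by positivity) (by omega)]
  rw [Real.rpow_add (by linarith), Real.rpow_one, ← hb] at hlt
  obtain ⟨E', hE', hne, hdeg⟩ := exists_subfamily_degree_gt (fun e : Finset V => e)
    (D := 264 * k ^ 2 * r ^ 4 * b) (by positivity) univ E (fun _ _ => subset_univ _) (by
      rw [card_univ, ← hn]
      linarith)
  -- The factor `2` in `a = 2 * b` ensures `a ≥ 2` and yields `2 ^ k * n > n` vertices at height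
  -- `k`.
  obtain ⟨T, hT, -, -⟩ := LinearTree.exists_large (E := E') (a := 2 * b)
    (d := 264 * k ^ 2 * r ^ 4 * b)
    (fun e he f hf => hlin e (hE' he) f (hE' hf)) (fun e he => hcard e (hE' he)) hr hk hG
    (fun e he => hEG e (hE' he)) hcopy (by linarith) (by linarith)
    (fun e he v hv => (hdeg e he v hv).le) hne k le_rfl
  have h1 : (#{v | T.lev v ≤ k} : ℝ) ≤ n := by exact_mod_cast card_le_univ _
  have h2 : (2 : ℝ) ≤ 2 ^ k := le_self_pow₀ (by norm_num) (by omega)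
  rw [mul_pow, hbk] at hT
  nlinarith

theorem corollary1p4 (r k : ℕ) (hr : 3 ≤ r) (hk : 2 ≤ k) (n : ℕ) :
    (Hypergraph.linearTuranNumber n r (Hypergraph.linearCycle r (2 * k)) : ℝ) ≤
      64 * (k : ℝ) ^ 2 * (r : ℝ) ^ (2 * r + 3) * (n : ℝ) ^ (1 + 1 / (k : ℝ)) := by
  classical
  obtain ⟨G, hG, huni, hlin, hcopy, hm⟩ := (Hypergraph.isGreatest_linearTuranNumber n r
    (Hypergraph.linearCycle r (2 * k)) ⟨_, 0, rfl⟩).1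
  rw [← hm]
  set E : Finset (Finset (Fin n)) := {e | (e : Set (Fin n)) ∈ G.edgeSet} with hE
  have hmem : ∀ e ∈ E, (e : Set (Fin n)) ∈ G.edgeSet := fun e he => (mem_filter.1 he).2
  have hEcard : G.edgeSet.ncard = #E := by
    have himage : G.edgeSet = (fun e : Finset (Fin n) => (e : Set (Fin n))) '' E := by
      ext s
      constructor
      · intro hs
        exact ⟨s.toFinset, by simpa [hE] using hs, by simp⟩
      · rintro ⟨e, he, rfl⟩
        exact hmem e he
    rw [himage, Set.ncard_image_of_injective _ coe_injective, Set.ncard_coe_finset]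
  have hmain := Hypergraph.card_edges_le_of_not_containsCopy (E := E) (r := r) (k := k) ?_ ?_
    (by omega) (by omega) hG hmem hcopy
  · rw [hEcard]
    rw [Fintype.card_fin] at hmain
    refine hmain.trans ?_
    have hr3 : (3 : ℝ) ≤ r := by exact_mod_cast hr
    -- Since `2 * r + 3 ≥ 9`, it is enough that `264 ≤ 64 * 3 ^ 5`.
    have hpow : (r : ℝ) ^ (4 + 5) ≤ (r : ℝ) ^ (2 * r + 3) :=
      pow_le_pow_right₀ (by linarith) (by omega)
    have h5 : (3 : ℝ) ^ 5 ≤ (r : ℝ) ^ 5 := pow_le_pow_left₀ (by norm_num) hr3 5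
    have hkey : 264 * (r : ℝ) ^ 4 ≤ 64 * (r : ℝ) ^ (2 * r + 3) := by
      rw [pow_add] at hpow
      nlinarith [pow_pos (by linarith : (0 : ℝ) < r) 4]
    calc 264 * (k : ℝ) ^ 2 * (r : ℝ) ^ 4 * (n : ℝ) ^ (1 + 1 / (k : ℝ))
        = (k : ℝ) ^ 2 * (264 * (r : ℝ) ^ 4) * (n : ℝ) ^ (1 + 1 / (k : ℝ)) := by ring
      _ ≤ (k : ℝ) ^ 2 * (64 * (r : ℝ) ^ (2 * r + 3)) * (n : ℝ) ^ (1 + 1 / (k : ℝ)) := by gcongr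
      _ = _ := by ring
  · intro e he f hf hef
    have := hlin e (hmem e he) f (hmem f hf) (by simpa using hef)
    rw [← coe_inter, Set.encard_coe_eq_coe_finsetCard] at this
    exact_mod_cast this
  · intro e he
    have := huni e (hmem e he)
    rw [Set.encard_coe_eq_coe_finsetCard] at this
    exact_mod_cast this
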